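/- There is an absolute constant $\epsilon_0>0$ such that for every integer $k\ge 1$ and every $c>0$ there is a constant $C=C(c,k)>0$ with the following property. Let $0<\epsilon\le\epsilon_0$ and $a>0$ be constants, and let $(G_i)_{i\in\mathbb N}$ be a sequence of graphs, where $G=G_i$ is a $d$-regular graph on $n$ vertices ($d=d_i$, $n=n_i$) with $n\to\infty$, $d\to\infty$ and $d\le n^{1-a}$. For $U\subseteq V(G)$ let $e(U,U^C)$ be the number of edges of $G$ with exactly one endpoint in $U$, and suppose that 1. $e(U,U^C)\ge c|U|$ for every $U\subseteq V(G)$ with $|U|\le n/2$; 2. $e(U,U^C)\ge(1-\epsilon)d|U|$ for every $U\subseteq V(G)$ with $|U|\le Cd\log n$. Let $\phi=\phi_i\to\infty$ slowly, in the sense that $\phi=n^{o(1)}$, and let $p=1-(\phi/n)^{1/d}$ (which lies in $[0,1]$ for all large $i$). Let $G_p$ be the random subgraph of $G$ on the same vertex set in which every edge of $G$ is retained independently with probability $p$. A graph is $k$-connected if it has more than $k$ vertices and remains connected after the deletion of any set of fewer than $k$ vertices; a $k$-connected component of a graph is a maximal $k$-connected subgraph. Then, with probability tending to $1$ as $i\to\infty$,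 $G_p$ has exactly one $k$-connected component, every vertex outside this component has degree at most $k-1$ in $G_p$, and any two distinct vertices outside it are at distance at least two in $G$ (that is, they are non-adjacent in $G$). -/

import Mathlib

open MeasureTheory ProbabilityTheory Filter Topology

noncomputable section

namespace Percolation

variable {V : Type*}

/-- The law of the random subgraph `G_p`: every edge of `G` is retained independently with
probability `p`, all vertices are kept. -/
def randomSubgraph (G : SimpleGraph V) (p : unitInterval) : Measure (SimpleGraph V) :=
  (setBernoulli G.edgeSet p).map SimpleGraph.fromEdgeSet

open scoped Classical in
/-- `e_G(U, Uᶜ)`, the number of edges of `G` with exactly one endpoint in `U`. -/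
def edgeBoundaryCard [Fintype V] (G : SimpleGraph V) (U : Finset V) : ℕ :=
  (G.interedges U Uᶜ).card

/-- `G` is `d`-regular. -/
def IsRegular (G : SimpleGraph V) (d : ℕ) : Prop :=
  ∀ v, (G.neighborSet v).ncard = d

/-- Global edge-expansion: `e(U, Uᶜ) ≥ c |U|` whenever `|U| ≤ n / 2`, where `n = |V|`. -/
def GlobalExpansion [Fintype V] (G : SimpleGraph V) (c : ℝ) : Prop :=
  ∀ U : Finset V, (U.card : ℝ) ≤ (Fintype.card V : ℝ) / 2 →
    c * U.card ≤ edgeBoundaryCard G U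

/-- Local edge-expansion: `e(U, Uᶜ) ≥ (1 - ε) d |U|` whenever `|U| ≤ C d log n`,
where `n = |V|`. -/
def LocalExpansion [Fintype V] (G : SimpleGraph V) (d : ℕ) (C ε : ℝ) : Prop :=
  ∀ U : Finset V, (U.card : ℝ) ≤ C * d * Real.log (Fintype.card V) →
    (1 - ε) * d * U.card ≤ edgeBoundaryCard G U

/-- The induced subgraph `H[S]` is `k`-connected: it has more than `k` vertices and stays connected
after deleting any fewer than `k` vertices. -/
def IsKConnectedOn [Finite V] (H : SimpleGraph V) (k : ℕ) (S : Set V) : Prop :=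
  k < S.ncard ∧ ∀ X : Set V, X.ncard < k → (H.induce (S \ X)).Connected

/-- `S` is the vertex set of a `k`-connected component of `H`, that is, of a maximal `k`-connected
subgraph. (Adding edges preserves `k`-connectedness, so a maximal `k`-connected subgraph is
induced, and it is determined by its vertex set.) -/
def IsKConnectedComponent [Finite V] (H : SimpleGraph V) (k : ℕ) (S : Set V) : Prop :=
  Maximal (IsKConnectedOn H k) S

/-- The event of the result, for a subgraph `H` of `G` on the same vertex set: `H` has exactly one
`k`-connected component, every vertex outside it has degree at most `k - 1` in `H`, and any two
distinct vertices outside it are at distance at least two in `G`. -/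
def HasUniqueKConnectedComponent [Finite V] (G : SimpleGraph V) (k : ℕ) (H : SimpleGraph V) :
    Prop :=
  ∃ S : Set V, IsKConnectedComponent H k S ∧
    (∀ T : Set V, IsKConnectedComponent H k T → T = S) ∧
    (∀ v, v ∉ S → (H.neighborSet v).ncard ≤ k - 1) ∧
    (∀ u v, u ∉ S → v ∉ S → u ≠ v → 2 ≤ G.edist u v)

end Percolation

end

set_option linter.unusedSectionVars false

/-! A fixed vertex is isolated in `G_p` with probability φ/n, so vertices of degree below k do
occur; the point is that they are the only obstruction. The edges are exposed in two independent
rounds, the second of density 6(k+1)/d. Splitting it off changes the d-th power of the removal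
probability only by a constant factor.

In the first round, local expansion and a union bound over rooted trees (`card_rootedTrees_le`)
exclude connected sets of 2 to C d log n vertices that send out at most k edges per vertex
(`bernProb_exists_isNearlyIsolated_le`). The cost per vertex is about n^(-3/4), which beats the n
choices of a root as soon as there are two vertices. A similar estimate, where d ≤ n^(1-a) is
needed, excludes adjacent vertices both of degree below k (`bernProb_exists_adj_low_le`).

Now delete a set X of fewer than k vertices. Each component of the remaining vertices of degree at
least k has, together with the low vertices attached to it, more than C d log n vertices
(`lt_card_attach`). If the graph is still disconnected after the second round, that round separates
a family of these components from the others. Let m be the number of components on the side with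
fewer of them. Global expansion gives a cut of weight of order m d log n (`le_majorityCut`), each
unit of which joins the sides with probability of order 1/d: by an edge between them, or by a low
vertex that receives an edge to one side and k edges to the other. Separation thus has probability
at most n^(-(k+2)m), which beats both the choices of the family and the at most k n^k choices of X.
Taking whole components as units makes this union bound affordable.

Hence the vertices of degree at least k form a k-connected set. It contains every k-connected set,
since all degrees in such a set are at least k (`hasUniqueKConnectedComponent_of_connected`). -/

namespace Percolation

/-! ### Product Bernoulli measure on a finite set, as a finite sum -/

section BernoulliExpectation

variable {α : Type*} [DecidableEq α]

/-- Expectation of `f` over a random subset of `E` in which every element is retained independently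
with probability `p`. -/
noncomputable def bernExp (E : Finset α) (p : ℝ) (f : Finset α → ℝ) : ℝ :=
  ∑ ω ∈ E.powerset, p ^ ω.card * (1 - p) ^ (E \ ω).card * f ω

open scoped Classical in
/-- Probability of the event `A` for a random subset of `E` in which every element is retained
independently with probability `p`. -/
noncomputable def bernProb (E : Finset α) (p : ℝ) (A : Finset α → Prop) : ℝ :=
  bernExp E p fun ω => if A ω then 1 else 0

lemma bernExp_congr {E : Finset α} {p : ℝ} {f g : Finset α → ℝ} (h : ∀ ω ⊆ E, f ω = g ω) :
    bernExp E p f = bernExp E p g :=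
  Finset.sum_congr rfl fun ω hω => by rw [h ω (Finset.mem_powerset.1 hω)]

lemma bernExp_mono {E : Finset α} {p : ℝ} (h0 : 0 ≤ p) (h1 : p ≤ 1) {f g : Finset α → ℝ}
    (h : ∀ ω ⊆ E, f ω ≤ g ω) : bernExp E p f ≤ bernExp E p g :=
  Finset.sum_le_sum fun ω hω => by
    have := sub_nonneg.2 h1
    exact mul_le_mul_of_nonneg_left (h ω (Finset.mem_powerset.1 hω)) (by positivity)

lemma bernExp_const_mul (E : Finset α) (p a : ℝ) (f : Finset α → ℝ) :
    bernExp E p (fun ω => a * f ω) = a * bernExp E p f := by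
  simp only [bernExp, Finset.mul_sum]
  exact Finset.sum_congr rfl fun ω _ => by ring

lemma bernExp_mul_const (E : Finset α) (p a : ℝ) (f : Finset α → ℝ) :
    bernExp E p (fun ω => f ω * a) = bernExp E p f * a := by
  simp only [bernExp, Finset.sum_mul]
  exact Finset.sum_congr rfl fun ω _ => by ring

lemma bernExp_add (E : Finset α) (p : ℝ) (f g : Finset α → ℝ) :
    bernExp E p (fun ω => f ω + g ω) = bernExp E p f + bernExp E p g := by
  simp only [bernExp, mul_add, Finset.sum_add_distrib]

lemma bernExp_sum {ι : Type*} (E : Finset α) (p : ℝ) (s : Finset ι) (f : ι → Finset α → ℝ) :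
    bernExp E p (fun ω => ∑ i ∈ s, f i ω) = ∑ i ∈ s, bernExp E p (f i) := by
  simp only [bernExp, Finset.mul_sum]
  exact Finset.sum_comm

/-- The binomial theorem. At x = 1 it gives total mass one; for x < 1 it is the moment behind all
lower-tail bounds below. -/
lemma bernExp_pow_card (E : Finset α) (p x : ℝ) :
    bernExp E p (fun ω => x ^ ω.card) = (1 - p + p * x) ^ E.card := by
  rw [add_comm (1 - p), ← Finset.sum_pow_mul_eq_add_pow]
  refine Finset.sum_congr rfl fun ω hω => ?_
  rw [Finset.card_sdiff_of_subset (Finset.mem_powerset.1 hω), mul_pow]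
  ring

lemma bernExp_const (E : Finset α) (p a : ℝ) : bernExp E p (fun _ => a) = a := by
  have := bernExp_pow_card E p 1
  simp only [one_pow, mul_one, sub_add_cancel] at this
  have h := bernExp_const_mul E p a (fun _ => 1)
  rw [this] at h
  simpa using h

lemma bernExp_empty (p : ℝ) (f : Finset α → ℝ) : bernExp ∅ p f = f ∅ := by
  simp [bernExp]

lemma bernExp_insert {E : Finset α} {e : α} (he : e ∉ E) (p : ℝ) (f : Finset α → ℝ) :
    bernExp (insert e E) p f
      = p * bernExp E p (fun ω => f (insert e ω)) + (1 - p) * bernExp E p f := by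
  rw [bernExp, Finset.sum_powerset_insert he, add_comm, bernExp, bernExp, Finset.mul_sum,
    Finset.mul_sum]
  congr 1
  · refine Finset.sum_congr rfl fun ω hω => ?_
    have hω := Finset.mem_powerset.1 hω
    have h1 : e ∉ ω := fun h => he (hω h)
    have h2 : insert e E \ insert e ω = E \ ω := by grind
    rw [h2, Finset.card_insert_of_notMem h1]
    ring
  · refine Finset.sum_congr rfl fun ω hω => ?_
    have hω := Finset.mem_powerset.1 hω
    have h2 : insert e E \ ω = insert e (E \ ω) := by grind
    have h3 : e ∉ E \ ω := by grind
    rw [h2, Finset.card_insert_of_notMem h3]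
    ring

lemma bernExp_disjUnion {E₁ E₂ : Finset α} (h : Disjoint E₁ E₂) (p : ℝ) (f : Finset α → ℝ) :
    bernExp (E₁ ∪ E₂) p f = bernExp E₁ p fun ω₁ => bernExp E₂ p fun ω₂ => f (ω₁ ∪ ω₂) := by
  induction E₁ using Finset.induction_on generalizing f with
  | empty => simp [bernExp_empty]
  | insert e E₁ he ih =>
    rw [Finset.disjoint_insert_left] at h
    rw [Finset.insert_union, bernExp_insert (by simp [he, h.1]), bernExp_insert he, ih h.2, ih h.2]
    simp only [Finset.insert_union]

/-- Two-round exposure. -/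
lemma bernExp_sprinkle (E : Finset α) (p₁ p₂ : ℝ) (f : Finset α → ℝ) :
    bernExp E (1 - (1 - p₁) * (1 - p₂)) f
      = bernExp E p₁ fun ω₁ => bernExp E p₂ fun ω₂ => f (ω₁ ∪ ω₂) := by
  induction E using Finset.induction_on generalizing f with
  | empty => simp [bernExp_empty]
  | insert e E he ih =>
    rw [bernExp_insert he, bernExp_insert he, ih, ih]
    simp only [bernExp_insert he, Finset.insert_union, Finset.union_insert, Finset.insert_idem,
      bernExp_add, bernExp_const_mul]
    ring

lemma bernExp_inter {E F : Finset α} (h : F ⊆ E) (p : ℝ) (g : Finset α → ℝ) :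
    bernExp E p (fun ω => g (ω ∩ F)) = bernExp F p g := by
  have hd : Disjoint F (E \ F) := Finset.disjoint_sdiff
  rw [← Finset.union_sdiff_of_subset h, bernExp_disjUnion hd]
  refine bernExp_congr fun ω₁ h₁ => ?_
  rw [bernExp_congr (g := fun _ => g ω₁), bernExp_const]
  intro ω₂ h₂
  congr 1
  grind

lemma bernProb_inter {E F : Finset α} (h : F ⊆ E) (p : ℝ) (A : Finset α → Prop) :
    bernProb E p (fun ω => A (ω ∩ F)) = bernProb F p A := by
  classical
  exact bernExp_inter h p fun ω => if A ω then 1 else 0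

/-- Independence for two disjoint sets of elements. -/
lemma bernExp_mul_inter {E F₁ F₂ : Finset α} (h₁ : F₁ ⊆ E) (h₂ : F₂ ⊆ E) (hd : Disjoint F₁ F₂)
    (p : ℝ) (g₁ g₂ : Finset α → ℝ) :
    bernExp E p (fun ω => g₁ (ω ∩ F₁) * g₂ (ω ∩ F₂)) = bernExp F₁ p g₁ * bernExp F₂ p g₂ := by
  have h := bernExp_inter (Finset.union_subset h₁ h₂) p
    fun ω => g₁ (ω ∩ F₁) * g₂ (ω ∩ F₂)
  rw [bernExp_disjUnion hd] at h
  rw [bernExp_congr (g := fun ω => g₁ (ω ∩ (F₁ ∪ F₂) ∩ F₁) * g₂ (ω ∩ (F₁ ∪ F₂) ∩ F₂)), h,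
    ← bernExp_mul_const]
  · refine bernExp_congr fun ω₁ hω₁ => ?_
    rw [← bernExp_const_mul]
    refine bernExp_congr fun ω₂ hω₂ => ?_
    rw [Finset.disjoint_left] at hd
    congr 2 <;> grind
  · intro ω _
    congr 2 <;> grind

/-- Independence for a family of disjoint sets of elements. -/
lemma bernExp_prod_inter {ι : Type*} (s : Finset ι) {E : Finset α} (F : ι → Finset α)
    (hF : ∀ i ∈ s, F i ⊆ E) (hd : (s : Set ι).PairwiseDisjoint F) (p : ℝ)
    (g : ι → Finset α → ℝ) :
    bernExp E p (fun ω => ∏ i ∈ s, g i (ω ∩ F i)) = ∏ i ∈ s, bernExp (F i) p (g i) := by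
  classical
  induction s using Finset.induction_on generalizing E with
  | empty => simp [bernExp_const]
  | insert j s hj ih =>
    have hsub : s.biUnion F ⊆ E := by
      rw [Finset.biUnion_subset]
      exact fun i hi => hF i (Finset.mem_insert_of_mem hi)
    have hdj : Disjoint (F j) (s.biUnion F) := by
      rw [Finset.disjoint_biUnion_right]
      intro i hi
      exact hd (by simp) (by simp [hi]) (fun h => hj (h ▸ hi))
    have := bernExp_mul_inter (hF j (Finset.mem_insert_self _ _)) hsub hdj p (g j)
      (fun ω => ∏ i ∈ s, g i (ω ∩ F i))
    rw [Finset.prod_insert hj, ← ih (fun i hi => Finset.subset_biUnion_of_mem F hi)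
      (hd.subset (by simp)), ← this]
    refine bernExp_congr fun ω _ => ?_
    rw [Finset.prod_insert hj]
    congr 1
    refine Finset.prod_congr rfl fun i hi => ?_
    congr 1
    have := Finset.subset_biUnion_of_mem F hi
    grind

variable {E : Finset α} {p : ℝ}

lemma bernProb_nonneg (h0 : 0 ≤ p) (h1 : p ≤ 1) (A : Finset α → Prop) : 0 ≤ bernProb E p A := by
  rw [← bernExp_const E p 0]
  exact bernExp_mono h0 h1 fun ω _ => by split_ifs <;> norm_num

lemma bernProb_mono (h0 : 0 ≤ p) (h1 : p ≤ 1) {A B : Finset α → Prop} (h : ∀ ω ⊆ E, A ω → B ω) :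
    bernProb E p A ≤ bernProb E p B :=
  bernExp_mono h0 h1 fun ω hω => by
    have := h ω hω
    split_ifs <;> simp_all

lemma bernProb_le_one (h0 : 0 ≤ p) (h1 : p ≤ 1) (A : Finset α → Prop) : bernProb E p A ≤ 1 := by
  rw [← bernExp_const E p 1]
  exact bernExp_mono h0 h1 fun ω _ => by split_ifs <;> norm_num

lemma bernProb_not (A : Finset α → Prop) :
    bernProb E p (fun ω => ¬ A ω) = 1 - bernProb E p A := by
  rw [eq_sub_iff_add_eq, bernProb, bernProb, ← bernExp_add]
  refine (bernExp_congr fun ω _ => ?_).trans (bernExp_const E p 1)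
  split_ifs <;> simp_all

/-- Union bound. -/
lemma bernProb_exists_le {ι : Type*} (h0 : 0 ≤ p) (h1 : p ≤ 1) (s : Finset ι)
    (A : ι → Finset α → Prop) :
    bernProb E p (fun ω => ∃ i ∈ s, A i ω) ≤ ∑ i ∈ s, bernProb E p (A i) := by
  classical
  simp only [bernProb]
  rw [← bernExp_sum]
  refine bernExp_mono h0 h1 fun ω _ => ?_
  have hn : ∀ i ∈ s, (0 : ℝ) ≤ if A i ω then 1 else 0 := fun i _ => by split_ifs <;> norm_num
  split_ifs with h
  · obtain ⟨i, hi, hA⟩ := h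
    refine le_trans ?_ (Finset.single_le_sum hn hi)
    simp [hA]
  · exact Finset.sum_nonneg hn

/-- The probabilities of pairwise disjoint events add up to at most one. -/
lemma sum_bernProb_le_one {ι : Type*} (h0 : 0 ≤ p) (h1 : p ≤ 1) (s : Finset ι)
    (A : ι → Finset α → Prop)
    (h : ∀ ω ⊆ E, ∀ i ∈ s, ∀ j ∈ s, A i ω → A j ω → i = j) :
    ∑ i ∈ s, bernProb E p (A i) ≤ 1 := by
  classical
  rw [show ∑ i ∈ s, bernProb E p (A i) = bernExp E p fun ω => ∑ i ∈ s, if A i ω then (1 : ℝ) else 0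
    from (bernExp_sum E p s _).symm]
  refine (bernExp_mono h0 h1 fun ω hω => ?_).trans_eq (bernExp_const E p 1)
  rw [← Finset.natCast_card_filter]
  norm_cast
  refine Finset.card_le_one.2 fun i hi j hj => ?_
  rw [Finset.mem_filter] at hi hj
  exact h ω hω i hi.1 j hj.1 hi.2 hj.2

lemma bernProb_or_le (h0 : 0 ≤ p) (h1 : p ≤ 1) (A B : Finset α → Prop) :
    bernProb E p (fun ω => A ω ∨ B ω) ≤ bernProb E p A + bernProb E p B := by
  simp only [bernProb]
  rw [← bernExp_add]
  refine bernExp_mono h0 h1 fun ω _ => ?_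
  split_ifs <;> simp_all

/-- The elements of `T` are all retained and those of `F` are mostly removed. -/
lemma bernProb_subset_and_card_inter_le {T F : Finset α} (hT : T ⊆ E) (hF : F ⊆ E)
    (hd : Disjoint T F) (h0 : 0 ≤ p) (h1 : p ≤ 1) {x : ℝ} (hx0 : 0 < x) (hx1 : x ≤ 1) (m : ℕ) :
    bernProb E p (fun ω => T ⊆ ω ∧ (ω ∩ F).card ≤ m)
      ≤ p ^ T.card * ((x⁻¹) ^ m * (1 - p + p * x) ^ F.card) := by
  classical
  have hTT : bernExp T p (fun ω => if T ⊆ ω then (1 : ℝ) else 0) = p ^ T.card := by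
    rw [bernExp, Finset.sum_eq_single_of_mem T (by simp)]
    · simp
    · intro ω hω hne
      have : ¬ T ⊆ ω := fun h => hne (Finset.Subset.antisymm (Finset.mem_powerset.1 hω) h)
      simp [this]
  -- Exponential Markov inequality: since x ≤ 1, the indicator of |ω ∩ F| ≤ m is at most x^(-m) x^|ω
  -- ∩ F|. The factor for T is independent because T and F are disjoint.
  rw [← bernExp_pow_card, ← bernExp_const_mul, ← hTT,
    ← bernExp_mul_inter hT hF hd p (fun ω => if T ⊆ ω then (1 : ℝ) else 0)
      (fun ω => (x⁻¹) ^ m * x ^ ω.card)]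
  refine bernExp_mono h0 h1 fun ω _ => ?_
  split_ifs with h h' h'
  · rw [one_mul, inv_pow, inv_mul_eq_div, one_le_div (by positivity)]
    exact pow_le_pow_of_le_one hx0.le hx1 h.2
  · exact absurd (Finset.subset_inter h.1 subset_rfl) h'
  · positivity
  · simp

lemma bernProb_card_inter_le {F : Finset α} (hF : F ⊆ E)
    (h0 : 0 ≤ p) (h1 : p ≤ 1) {x : ℝ} (hx0 : 0 < x) (hx1 : x ≤ 1) (m : ℕ) :
    bernProb E p (fun ω => (ω ∩ F).card ≤ m) ≤ (x⁻¹) ^ m * (1 - p + p * x) ^ F.card := by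
  have := bernProb_subset_and_card_inter_le (Finset.empty_subset E) hF (by simp) h0 h1 hx0 hx1 m
  simpa using this

end BernoulliExpectation

/-! ### Edge cuts, and counting subtrees through a vertex -/

section Trees

open scoped Classical

variable {V : Type*} [Fintype V]

/-- The edges of `G` as a finite set. -/
noncomputable def edges (G : SimpleGraph V) : Finset (Sym2 V) :=
  Finset.univ.filter (· ∈ G.edgeSet)

@[simp] lemma mem_edges {G : SimpleGraph V} {e : Sym2 V} : e ∈ edges G ↔ e ∈ G.edgeSet := by
  simp [edges]

/-- The graph with edge set `ω`. -/
abbrev graphOf (ω : Finset (Sym2 V)) : SimpleGraph V :=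
  SimpleGraph.fromEdgeSet (ω : Set (Sym2 V))

lemma graphOf_adj_of_mem {G : SimpleGraph V} {ω : Finset (Sym2 V)} (hω : ω ⊆ edges G) {u v : V}
    (h : s(u, v) ∈ ω) : (graphOf ω).Adj u v := by
  rw [SimpleGraph.fromEdgeSet_adj]
  refine ⟨h, ?_⟩
  have := hω h
  rw [mem_edges, SimpleGraph.mem_edgeSet] at this
  exact this.ne

/-- The edges of `G` between `A` and `B`. -/
noncomputable def cutEdges (G : SimpleGraph V) (A B : Finset V) : Finset (Sym2 V) :=
  (G.interedges A B).image fun x => s(x.1, x.2)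

lemma mem_cutEdges {G : SimpleGraph V} {A B : Finset V} {e : Sym2 V} :
    e ∈ cutEdges G A B ↔ ∃ a ∈ A, ∃ b ∈ B, G.Adj a b ∧ s(a, b) = e := by
  simp only [cutEdges, Finset.mem_image, Prod.exists, SimpleGraph.mem_interedges_iff]
  grind

lemma mk_mem_cutEdges {G : SimpleGraph V} {A B : Finset V} {a b : V} (ha : a ∈ A) (hb : b ∈ B)
    (h : G.Adj a b) : s(a, b) ∈ cutEdges G A B :=
  mem_cutEdges.2 ⟨a, ha, b, hb, h, rfl⟩

lemma cutEdges_subset (G : SimpleGraph V) (A B : Finset V) : cutEdges G A B ⊆ edges G := by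
  intro e he
  obtain ⟨a, _, b, _, h, rfl⟩ := mem_cutEdges.1 he
  simpa using h

lemma card_cutEdges {G : SimpleGraph V} {A B : Finset V} (h : Disjoint A B) :
    (cutEdges G A B).card = (G.interedges A B).card := by
  refine Finset.card_image_of_injOn ?_
  rintro ⟨a, b⟩ h1 ⟨a', b'⟩ h2 heq
  simp only [Finset.mem_coe, SimpleGraph.mem_interedges_iff] at h1 h2
  rw [Finset.disjoint_left] at h
  simp only [Sym2.eq_iff] at heq
  grind

lemma card_cutEdges_compl (G : SimpleGraph V) (U : Finset V) :
    (cutEdges G U Uᶜ).card = edgeBoundaryCard G U :=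
  card_cutEdges disjoint_compl_right

/-- The edges of `G` that meet `U`. -/
noncomputable def incEdges (G : SimpleGraph V) (U : Finset V) : Finset (Sym2 V) :=
  cutEdges G U Finset.univ

lemma card_neighbors {G : SimpleGraph V} {d : ℕ} (hG : IsRegular G d) (v : V) :
    (Finset.univ.filter (G.Adj v)).card = d := by
  rw [← hG v, ← Set.ncard_coe_finset]
  congr 1
  ext
  simp

lemma card_interedges_eq_sum (G : SimpleGraph V) (A B : Finset V) :
    (G.interedges A B).card = ∑ v ∈ A, (B.filter (G.Adj v)).card := by
  rw [SimpleGraph.interedges, Rel.interedges, Finset.card_filter, Finset.sum_product]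
  simp only [Finset.card_filter]

lemma card_interedges_le {G : SimpleGraph V} {d : ℕ} (hG : IsRegular G d) (A B : Finset V) :
    (G.interedges A B).card ≤ d * A.card := by
  rw [card_interedges_eq_sum, mul_comm, ← smul_eq_mul]
  refine Finset.sum_le_card_nsmul _ _ _ fun v _ => ?_
  rw [← card_neighbors hG v]
  exact Finset.card_le_card (Finset.filter_subset_filter _ (Finset.subset_univ _))

lemma incEdges_subset (G : SimpleGraph V) (U : Finset V) : incEdges G U ⊆ edges G :=
  cutEdges_subset _ _ _

lemma card_incEdges_le {G : SimpleGraph V} {d : ℕ} (hG : IsRegular G d) (U : Finset V) :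
    (incEdges G U).card ≤ d * U.card :=
  Finset.card_image_le.trans (card_interedges_le hG U _)

/-- `T` is the edge set of a subtree of `G` with vertex set `U`. -/
structure IsTreeOn (G : SimpleGraph V) (U : Finset V) (T : Finset (Sym2 V)) : Prop where
  subset : T ⊆ edges G
  mem_of_mem : ∀ e ∈ T, ∀ v ∈ e, v ∈ U
  card_eq : T.card + 1 = U.card
  reachable : ∀ u ∈ U, ∀ v ∈ U, (graphOf T).Reachable u v

lemma mem_of_reachable {K : SimpleGraph V} {U : Set V}
    (hU : ∀ a ∈ U, ∀ b, K.Adj a b → b ∈ U) {u v : V} (hu : u ∈ U) (h : K.Reachable u v) :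
    v ∈ U := by
  obtain ⟨w⟩ := h
  induction w with
  | nil => exact hu
  | cons h _ ih => exact ih (hU _ hu _ h)

lemma exists_isTreeOn {G : SimpleGraph V} {ω : Finset (Sym2 V)} (hω : ω ⊆ edges G) {U : Finset V}
    (hU : ((graphOf ω).induce (U : Set V)).Connected) : ∃ T ⊆ ω, IsTreeOn G U T := by
  obtain ⟨F, hF, hT⟩ := hU.exists_isTree_le
  have hinj : Function.Injective (Sym2.map (Subtype.val : ↥(U : Set V) → V)) :=
    Sym2.map.injective Subtype.val_injective
  have hmem : ∀ a b, F.Adj a b → s(a.1, b.1) ∈ ω := by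
    intro a b h
    have := hF h
    simpa using this.1
  refine ⟨F.edgeFinset.image (Sym2.map Subtype.val), ?_, ?_, ?_, ?_, ?_⟩
  · intro e he
    obtain ⟨f, hf, rfl⟩ := Finset.mem_image.1 he
    induction f with | _ a b => exact hmem a b (by simpa using hf)
  · intro e he
    obtain ⟨f, hf, rfl⟩ := Finset.mem_image.1 he
    induction f with | _ a b => exact hω (hmem a b (by simpa using hf))
  · intro e he v hv
    obtain ⟨f, hf, rfl⟩ := Finset.mem_image.1 he
    induction f with | _ a b =>
    simp only [Sym2.map_mk, Sym2.mem_iff] at hv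
    rcases hv with rfl | rfl
    · exact a.2
    · exact b.2
  · rw [Finset.card_image_of_injective _ hinj, hT.card_edgeFinset]
    simp
  · intro u hu v hv
    let φ : F →g graphOf (F.edgeFinset.image (Sym2.map Subtype.val)) :=
      ⟨Subtype.val, fun {a b} h => by
        rw [SimpleGraph.fromEdgeSet_adj]
        refine ⟨?_, fun h' => h.ne (Subtype.ext h')⟩
        rw [Finset.mem_coe, Finset.mem_image]
        exact ⟨s(a, b), by simpa using h, rfl⟩⟩
    exact (hT.connected.preconnected ⟨u, hu⟩ ⟨v, hv⟩).map φ

lemma bernProb_inter_eq {α : Type*} [DecidableEq α] {E F T : Finset α} (hF : F ⊆ E) (hT : T ⊆ F)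
    (p : ℝ) :
    bernProb E p (fun ω => ω ∩ F = T) = p ^ T.card * (1 - p) ^ (F.card - T.card) := by
  rw [bernProb_inter hF p (· = T), bernProb, bernExp,
    Finset.sum_eq_single_of_mem T (by simpa using hT)]
  · simp [Finset.card_sdiff_of_subset hT]
  · intro ω _ hne
    simp [hne]

/-- The subtrees of `G` on `s` vertices one of which is `v`. -/
noncomputable def rootedTrees (G : SimpleGraph V) (v : V) (s : ℕ) :
    Finset (Finset V × Finset (Sym2 V)) :=
  Finset.univ.filter fun x => v ∈ x.1 ∧ x.1.card = s ∧ IsTreeOn G x.1 x.2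

lemma IsTreeOn.subset_incEdges {G : SimpleGraph V} {U : Finset V} {T : Finset (Sym2 V)}
    (h : IsTreeOn G U T) : T ⊆ incEdges G U := by
  intro e he
  have h1 := h.subset he
  have h2 := h.mem_of_mem e he
  induction e with | _ a b =>
  exact mk_mem_cutEdges (h2 a (by simp)) (Finset.mem_univ _) (by simpa using h1)

/-- No edge of ω leaves U and T already connects U, so U is the cluster of v. Hence ω determines the
pair (U, T), and the events for different trees through v are disjoint. -/
lemma IsTreeOn.eq_cluster {G : SimpleGraph V} {U : Finset V} {T ω : Finset (Sym2 V)}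
    (h : IsTreeOn G U T) (hω : ω ⊆ edges G) (hT : ω ∩ incEdges G U = T) {v : V} (hv : v ∈ U) :
    U = Finset.univ.filter ((graphOf ω).Reachable v) := by
  ext w
  rw [Finset.mem_filter]
  constructor
  · intro hw
    refine ⟨Finset.mem_univ _, (h.reachable v hv w hw).mono ?_⟩
    refine SimpleGraph.fromEdgeSet_mono ?_
    rw [← hT]
    exact_mod_cast Finset.inter_subset_left
  · rintro ⟨-, hw⟩
    refine mem_of_reachable (U := (U : Set V)) ?_ hv hw
    intro a ha b hab
    have hab' : s(a, b) ∈ ω := by simpa using hab.1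
    have : s(a, b) ∈ T := by
      rw [← hT, Finset.mem_inter]
      exact ⟨hab', mk_mem_cutEdges ha (Finset.mem_univ _) (by simpa using hω hab')⟩
    exact h.mem_of_mem _ this b (by simp)

/-- Counting by percolation: retain edges with probability x. The events that the cluster of v is
spanned by exactly a given tree are disjoint, and each has probability at least the displayed
factor, as at most ds edges meet s vertices. -/
lemma card_rootedTrees_mul_le {G : SimpleGraph V} {d : ℕ} (hG : IsRegular G d) (v : V) (s : ℕ)
    {x : ℝ} (h0 : 0 ≤ x) (h1 : x ≤ 1) :
    ((rootedTrees G v s).card : ℝ) * (x ^ (s - 1) * (1 - x) ^ (d * s)) ≤ 1 := by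
  have h1x : 0 ≤ 1 - x := sub_nonneg.2 h1
  calc ((rootedTrees G v s).card : ℝ) * (x ^ (s - 1) * (1 - x) ^ (d * s))
      = ∑ y ∈ rootedTrees G v s, x ^ (s - 1) * (1 - x) ^ (d * s) := by
        rw [Finset.sum_const, nsmul_eq_mul]
    _ ≤ ∑ y ∈ rootedTrees G v s, bernProb (edges G) x fun ω => ω ∩ incEdges G y.1 = y.2 := by
        refine Finset.sum_le_sum fun y hy => ?_
        obtain ⟨-, -, hs, ht⟩ := Finset.mem_filter.1 hy
        rw [bernProb_inter_eq (incEdges_subset _ _) ht.subset_incEdges]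
        have h2 : y.2.card = s - 1 := by have := ht.card_eq; omega
        rw [h2]
        refine mul_le_mul_of_nonneg_left (pow_le_pow_of_le_one h1x (by linarith) ?_)
          (by positivity)
        have := card_incEdges_le hG y.1
        rw [hs] at this
        omega
    _ ≤ 1 := by
        refine sum_bernProb_le_one h0 h1 _ _ ?_
        rintro ω hω ⟨U, T⟩ hy ⟨U', T'⟩ hy' hT hT'
        simp only [rootedTrees, Finset.mem_filter, Finset.mem_univ, true_and] at hy hy'
        have e1 := hy.2.2.eq_cluster hω hT hy.1
        have e2 := hy'.2.2.eq_cluster hω hT' hy'.1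
        have e3 : U = U' := e1.trans e2.symm
        subst e3
        rw [Prod.mk.injEq]
        exact ⟨rfl, hT.symm.trans hT'⟩

/-- In a `d`-regular graph there are at most `(4d)^s` rooted subtrees on `s` vertices. -/
lemma card_rootedTrees_le {G : SimpleGraph V} {d : ℕ} (hG : IsRegular G d) (hd : 1 ≤ d) (v : V)
    {s : ℕ} (hs : 1 ≤ s) : ((rootedTrees G v s).card : ℝ) ≤ 4 ^ s * (d : ℝ) ^ (s - 1) := by
  have hd' : (1 : ℝ) ≤ d := by exact_mod_cast hd
  -- With x = 1/(2d), a tree edge costs a factor 2d, while by Bernoulli's inequality all the removed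
  -- edges together cost at most 2^s.
  have hx : (2 * (d : ℝ))⁻¹ ≤ 1 / 2 := by
    rw [inv_le_comm₀ (by positivity) (by norm_num)]
    linarith
  have hx0 : 0 ≤ (2 * (d : ℝ))⁻¹ := by positivity
  have h := card_rootedTrees_mul_le hG v s hx0 (by linarith)
  have hb : (1 / 2 : ℝ) ≤ (1 - (2 * (d : ℝ))⁻¹) ^ d := by
    have := one_add_mul_le_pow (a := -(2 * (d : ℝ))⁻¹) (by linarith) d
    have e : (d : ℝ) * -(2 * (d : ℝ))⁻¹ = -(1 / 2) := by field_simp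
    rw [e] at this
    calc (1 / 2 : ℝ) = 1 + -(1 / 2) := by norm_num
      _ ≤ _ := this
      _ = _ := by ring
  have hb2 : (1 / 2 : ℝ) ^ s ≤ (1 - (2 * (d : ℝ))⁻¹) ^ (d * s) := by
    rw [pow_mul]
    exact pow_le_pow_left₀ (by norm_num) hb s
  have h3 : ((rootedTrees G v s).card : ℝ) * ((2 * (d : ℝ))⁻¹ ^ (s - 1) * (1 / 2) ^ s) ≤ 1 := by
    refine le_trans ?_ h
    gcongr
  have h4 : (2 * (d : ℝ))⁻¹ ^ (s - 1) * (1 / 2 : ℝ) ^ s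
      = ((2 : ℝ) ^ (s - 1) * 2 ^ s * (d : ℝ) ^ (s - 1))⁻¹ := by
    rw [inv_pow, mul_pow, one_div, inv_pow, ← mul_inv]
    congr 1
    ring
  rw [h4, ← div_eq_mul_inv, div_le_one (by positivity)] at h3
  refine h3.trans ?_
  have h5 : (2 : ℝ) ^ (s - 1) ≤ 2 ^ s := pow_le_pow_right₀ (by norm_num) (by omega)
  have h6 : (4 : ℝ) ^ s = 2 ^ s * 2 ^ s := by rw [← mul_pow]; norm_num
  rw [h6]
  gcongr

end Trees

/-! ### First round: nearly isolated sets and adjacent low vertices -/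

section FirstRound

open scoped Classical

variable {V : Type*} [Fintype V]

/-- `U` spans a connected subgraph of `ω` and sends at most `k |U|` edges of `ω` outside. -/
def IsNearlyIsolated (G : SimpleGraph V) (k : ℕ) (ω : Finset (Sym2 V)) (U : Finset V) : Prop :=
  ((graphOf ω).induce (U : Set V)).Connected ∧ (ω ∩ cutEdges G U Uᶜ).card ≤ k * U.card

/-- The lower-tail bound with parameter 1/Λ replaces the removal probability q by r = q + p/Λ. If dp
≤ Λq this is at most q(1 + 1/d), so over d edges the loss is only a factor e. -/
lemma pow_mix_le {q r : ℝ} {d : ℕ} (hd : 1 ≤ d) (hq : 0 ≤ q) (hr0 : 0 ≤ r)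
    (hr : r ≤ q * (1 + 1 / d)) : r ^ d ≤ Real.exp 1 * q ^ d := by
  have hd' : (0 : ℝ) < d := by exact_mod_cast hd
  calc r ^ d ≤ (q * (1 + 1 / d)) ^ d := pow_le_pow_left₀ hr0 hr d
    _ = (1 + 1 / d : ℝ) ^ d * q ^ d := by rw [mul_pow, mul_comm]
    _ ≤ (Real.exp (1 / d)) ^ d * q ^ d := by
        gcongr
        rw [add_comm]
        exact Real.add_one_le_exp _
    _ = Real.exp 1 * q ^ d := by
        rw [← Real.exp_nat_mul]
        congr 2
        field_simp

lemma pow_boundary_le {q r : ℝ} {d s m : ℕ} (hd : 1 ≤ d) (hq : 0 ≤ q)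
    (hr0 : 0 < r) (hr1 : r ≤ 1) (hr : r ≤ q * (1 + 1 / d)) (hm : 3 / 4 * (d : ℝ) * s ≤ m) :
    r ^ m ≤ (Real.exp 1 * (q ^ d) ^ (3 / 4 : ℝ)) ^ s := by
  have h1 : r ^ m ≤ ((r ^ d) ^ (3 / 4 : ℝ)) ^ s := by
    rw [← Real.rpow_natCast r d, ← Real.rpow_mul hr0.le, ← Real.rpow_natCast _ s,
      ← Real.rpow_mul hr0.le, ← Real.rpow_natCast r m]
    exact Real.rpow_le_rpow_of_exponent_ge hr0 hr1 (by linarith)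
  refine h1.trans (pow_le_pow_left₀ (by positivity) ?_ s)
  calc (r ^ d) ^ (3 / 4 : ℝ) ≤ (Real.exp 1 * q ^ d) ^ (3 / 4 : ℝ) :=
        Real.rpow_le_rpow (by positivity) (pow_mix_le hd hq hr0.le hr) (by norm_num)
    _ = Real.exp 1 ^ (3 / 4 : ℝ) * (q ^ d) ^ (3 / 4 : ℝ) :=
        Real.mul_rpow (Real.exp_pos 1).le (by positivity)
    _ ≤ Real.exp 1 * (q ^ d) ^ (3 / 4 : ℝ) := by
        gcongr
        rw [← Real.exp_mul, Real.exp_le_exp]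
        norm_num

lemma sum_Icc_two_pow_le {y : ℝ} (h0 : 0 ≤ y) (h1 : y ≤ 1 / 2) (n : ℕ) :
    ∑ s ∈ Finset.Icc 2 n, y ^ s ≤ 2 * y ^ 2 := by
  have hlt : y < 1 := by linarith
  have := geom_sum_Ico_le_of_lt_one (m := 2) (n := n + 1) h0 hlt
  have e : Finset.Icc 2 n = Finset.Ico 2 (n + 1) := by ext; simp
  rw [e]
  refine this.trans ?_
  rw [div_le_iff₀ (by linarith)]
  nlinarith [sq_nonneg y]

variable {G : SimpleGraph V} {d : ℕ} {p q Λ : ℝ}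

/-- With high probability no small connected set is nearly isolated. -/
lemma bernProb_exists_isNearlyIsolated_le (hG : IsRegular G d) (hd : 1 ≤ d) {C ε : ℝ}
    (hloc : LocalExpansion G d C ε) (hε : ε ≤ 1 / 4) (hp0 : 0 ≤ p) (hq0 : 0 < q) (hpq : 1 - p = q)
    (hΛ1 : 1 ≤ Λ) (hΛ : d * p ≤ Λ * q) (k : ℕ) {y : ℝ}
    (hy : 4 * Real.exp 1 * Λ ^ (k + 1) * (q ^ d) ^ (3 / 4 : ℝ) ≤ y) (hy1 : y ≤ 1 / 2) :
    bernProb (edges G) p (fun ω => ∃ U : Finset V, 2 ≤ U.card ∧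
      (U.card : ℝ) ≤ C * d * Real.log (Fintype.card V) ∧ IsNearlyIsolated G k ω U)
      ≤ 2 * Fintype.card V * y ^ 2 := by
  have hd' : (0 : ℝ) < d := by exact_mod_cast hd
  have hp1 : p ≤ 1 := by linarith
  have hΛ0 : 0 < Λ := by linarith
  have hx1 : Λ⁻¹ ≤ 1 := inv_le_one_of_one_le₀ hΛ1
  set r : ℝ := 1 - p + p * Λ⁻¹ with hr
  have hr0 : 0 < r := by rw [hr, hpq]; positivity
  have hr1 : r ≤ 1 := by rw [hr]; nlinarith
  have hrq : r ≤ q * (1 + 1 / d) := by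
    rw [hr, hpq, mul_add, mul_one, mul_one_div, ← div_eq_mul_inv]
    gcongr q + ?_
    rw [div_le_div_iff₀ hΛ0 hd']
    linarith
  have hdp : (d : ℝ) * p ≤ Λ := hΛ.trans (by nlinarith)
  set b : ℝ := Real.exp 1 * (q ^ d) ^ (3 / 4 : ℝ) with hb
  have hb0 : 0 ≤ b := by positivity
  set D : ℝ := C * d * Real.log (Fintype.card V) with hD
  -- A nearly isolated set is witnessed by a spanning tree. The size bound is part of the event, so
  -- that either local expansion applies or the event is empty.
  set Q : ℕ → V → Finset V × Finset (Sym2 V) → Finset (Sym2 V) → Prop := fun s v x ω =>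
    (x.1.card : ℝ) ≤ D ∧ x.2 ⊆ ω ∧ (ω ∩ cutEdges G x.1 x.1ᶜ).card ≤ k * s with hQ
  have hy0 : 0 ≤ y := le_trans (by positivity) hy
  have hQle : ∀ s v, ∀ x ∈ rootedTrees G v s,
      bernProb (edges G) p (Q s v x) ≤ p ^ (s - 1) * (Λ ^ (k * s) * b ^ s) := by
    intro s v x hx
    obtain ⟨-, -, hs, ht⟩ := Finset.mem_filter.1 hx
    by_cases hsm : (x.1.card : ℝ) ≤ D
    · have hdis : Disjoint x.2 (cutEdges G x.1 x.1ᶜ) := by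
        rw [Finset.disjoint_left]
        intro e he he'
        obtain ⟨a, _, b, hb, _, rfl⟩ := mem_cutEdges.1 he'
        exact (Finset.mem_compl.1 hb) (ht.mem_of_mem _ he b (by simp))
      have h1 := bernProb_subset_and_card_inter_le (p := p) ht.subset (cutEdges_subset G x.1 x.1ᶜ)
        hdis hp0 hp1 (inv_pos.2 hΛ0) hx1 (k * s)
      rw [inv_inv, ← hr] at h1
      have hcard : x.2.card = s - 1 := by have := ht.card_eq; omega
      rw [hcard] at h1
      refine (bernProb_mono hp0 hp1 fun ω _ h => h.2).trans (h1.trans ?_)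
      refine mul_le_mul_of_nonneg_left ?_ (by positivity)
      refine mul_le_mul_of_nonneg_left ?_ (by positivity)
      refine pow_boundary_le hd hq0.le hr0 hr1 hrq ?_
      have := hloc x.1 hsm
      rw [← card_cutEdges_compl, hs] at this
      refine le_trans ?_ this
      gcongr
      linarith
    · calc bernProb (edges G) p (Q s v x) ≤ bernProb (edges G) p (fun _ => False) :=
            bernProb_mono hp0 hp1 fun ω _ h => hsm h.1
        _ = 0 := by simp [bernProb, bernExp_const]
        _ ≤ _ := by positivity
  calc bernProb (edges G) p (fun ω => ∃ U : Finset V, 2 ≤ U.card ∧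
      (U.card : ℝ) ≤ C * d * Real.log (Fintype.card V) ∧ IsNearlyIsolated G k ω U)
      ≤ bernProb (edges G) p (fun ω => ∃ s ∈ Finset.Icc 2 (Fintype.card V),
          ∃ v ∈ (Finset.univ : Finset V), ∃ x ∈ rootedTrees G v s, Q s v x ω) := by
        refine bernProb_mono hp0 hp1 fun ω hω => ?_
        rintro ⟨U, hU2, hUD, hconn, hcut⟩
        obtain ⟨T, hTω, hT⟩ := exists_isTreeOn hω hconn
        obtain ⟨v, hv⟩ := Finset.card_pos.1 (by omega : 0 < U.card)
        refine ⟨U.card, Finset.mem_Icc.2 ⟨hU2, Finset.card_le_univ U⟩, v, Finset.mem_univ v,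
          (U, T), ?_, hUD, hTω, hcut⟩
        simp [rootedTrees, hv, hT]
    _ ≤ ∑ s ∈ Finset.Icc 2 (Fintype.card V), ∑ v : V, ∑ x ∈ rootedTrees G v s,
          bernProb (edges G) p (Q s v x) := by
        refine (bernProb_exists_le hp0 hp1 _ _).trans (Finset.sum_le_sum fun s _ => ?_)
        refine (bernProb_exists_le hp0 hp1 _ _).trans (Finset.sum_le_sum fun v _ => ?_)
        exact bernProb_exists_le hp0 hp1 _ _
    _ ≤ ∑ s ∈ Finset.Icc 2 (Fintype.card V), Fintype.card V * y ^ s := by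
        refine Finset.sum_le_sum fun s hs => ?_
        have hs1 : 1 ≤ s := by have := (Finset.mem_Icc.1 hs).1; omega
        rw [← nsmul_eq_mul, ← Finset.card_univ]
        refine Finset.sum_le_card_nsmul _ _ _ fun v _ => ?_
        refine (Finset.sum_le_card_nsmul _ _ _ (hQle s v)).trans ?_
        rw [nsmul_eq_mul]
        calc ((rootedTrees G v s).card : ℝ) * (p ^ (s - 1) * (Λ ^ (k * s) * b ^ s))
            ≤ (4 ^ s * (d : ℝ) ^ (s - 1)) * (p ^ (s - 1) * (Λ ^ (k * s) * b ^ s)) := by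
              gcongr
              exact card_rootedTrees_le hG hd v hs1
          -- The d^(s-1) in the tree count is balanced by the probability p^(s-1) of the tree edges,
          -- leaving at most Λ per edge.
          _ = (d * p) ^ (s - 1) * (4 ^ s * (Λ ^ (k * s) * b ^ s)) := by rw [mul_pow]; ring
          _ ≤ Λ ^ s * (4 ^ s * (Λ ^ (k * s) * b ^ s)) := by
              gcongr
              calc ((d : ℝ) * p) ^ (s - 1) ≤ Λ ^ (s - 1) := by gcongr
                _ ≤ Λ ^ s := pow_le_pow_right₀ hΛ1 (by omega)
          _ = (4 * Real.exp 1 * Λ ^ (k + 1) * (q ^ d) ^ (3 / 4 : ℝ)) ^ s := by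
              rw [hb, pow_mul, ← mul_pow, ← mul_pow, ← mul_pow]
              congr 1
              ring
          _ ≤ y ^ s := by gcongr
    _ ≤ 2 * Fintype.card V * y ^ 2 := by
        rw [← Finset.mul_sum]
        have := sum_Icc_two_pow_le hy0 hy1 (Fintype.card V)
        calc (Fintype.card V : ℝ) * _ ≤ Fintype.card V * (2 * y ^ 2) := by gcongr
          _ = _ := by ring

lemma card_cutEdges_pair (hG : IsRegular G d) {u v : V} (huv : G.Adj u v) :
    2 * d - 2 ≤ (cutEdges G {u, v} {u, v}ᶜ).card := by
  rw [card_cutEdges disjoint_compl_right, card_interedges_eq_sum, Finset.sum_pair huv.ne]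
  have key : ∀ a b : V, G.Adj a b → ∀ S : Finset V, (∀ c, G.Adj a c → c ≠ b → c ∈ S) →
      d - 1 ≤ (S.filter (G.Adj a)).card := by
    intro a b hab S hS
    rw [← card_neighbors hG a, ← Finset.card_erase_of_mem (s := Finset.univ.filter (G.Adj a))
      (a := b) (by simpa using hab)]
    refine Finset.card_le_card fun c hc => ?_
    simp only [Finset.mem_erase, Finset.mem_filter, Finset.mem_univ, true_and] at hc ⊢
    exact ⟨hS c hc.2 hc.1, hc.2⟩
  have h1 := key u v huv ({u, v}ᶜ) fun c hc hcv => by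
    have := hc.ne
    simp only [Finset.mem_compl, Finset.mem_insert, Finset.mem_singleton]
    grind
  have h2 := key v u huv.symm ({u, v}ᶜ) fun c hc hcv => by
    have := hc.ne
    simp only [Finset.mem_compl, Finset.mem_insert, Finset.mem_singleton]
    grind
  omega

/-- With high probability no two adjacent vertices both have small degree. -/
lemma bernProb_exists_adj_low_le (hG : IsRegular G d) (hd : 1 ≤ d) (hp0 : 0 ≤ p) (hq0 : 0 < q)
    (hpq : 1 - p = q) (hΛ1 : 1 ≤ Λ) (hΛ : d * p ≤ Λ * q) (k : ℕ) :
    bernProb (edges G) p (fun ω => ∃ u v : V, G.Adj u v ∧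
      (ω ∩ cutEdges G {u, v} {u, v}ᶜ).card ≤ 2 * k)
      ≤ Fintype.card V * d * (Λ ^ (2 * k) * (Real.exp 1 * q ^ d) ^ 2 / q ^ 2) := by
  have hd' : (0 : ℝ) < d := by exact_mod_cast hd
  have hp1 : p ≤ 1 := by linarith
  have hΛ0 : 0 < Λ := by linarith
  have hx1 : Λ⁻¹ ≤ 1 := inv_le_one_of_one_le₀ hΛ1
  set r : ℝ := 1 - p + p * Λ⁻¹ with hr
  have hr0 : 0 < r := by rw [hr, hpq]; positivity
  have hr1 : r ≤ 1 := by rw [hr]; nlinarith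
  have hrq' : q ≤ r := by
    have : 0 ≤ p * Λ⁻¹ := by positivity
    rw [hr, hpq]
    linarith
  have hrq : r ≤ q * (1 + 1 / d) := by
    rw [hr, hpq, mul_add, mul_one, mul_one_div, ← div_eq_mul_inv]
    gcongr q + ?_
    rw [div_le_div_iff₀ hΛ0 hd']
    linarith
  calc bernProb (edges G) p (fun ω => ∃ u v : V, G.Adj u v ∧
      (ω ∩ cutEdges G {u, v} {u, v}ᶜ).card ≤ 2 * k)
      ≤ bernProb (edges G) p (fun ω => ∃ u ∈ (Finset.univ : Finset V),
          ∃ v ∈ Finset.univ.filter (G.Adj u), (ω ∩ cutEdges G {u, v} {u, v}ᶜ).card ≤ 2 * k) := by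
        refine bernProb_mono hp0 hp1 fun ω _ => ?_
        rintro ⟨u, v, huv, h⟩
        exact ⟨u, Finset.mem_univ u, v, by simpa using huv, h⟩
    _ ≤ ∑ u : V, ∑ v ∈ Finset.univ.filter (G.Adj u),
          bernProb (edges G) p (fun ω => (ω ∩ cutEdges G {u, v} {u, v}ᶜ).card ≤ 2 * k) := by
        refine (bernProb_exists_le hp0 hp1 _ _).trans (Finset.sum_le_sum fun u _ => ?_)
        exact bernProb_exists_le hp0 hp1 _ _
    _ ≤ ∑ u : V, ∑ v ∈ Finset.univ.filter (G.Adj u),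
          (Λ ^ (2 * k) * (Real.exp 1 * q ^ d) ^ 2 / q ^ 2) := by
        refine Finset.sum_le_sum fun u _ => Finset.sum_le_sum fun v hv => ?_
        have huv : G.Adj u v := by simpa using hv
        have h1 := bernProb_card_inter_le (p := p) (cutEdges_subset G {u, v} {u, v}ᶜ) hp0 hp1
          (inv_pos.2 hΛ0) hx1 (2 * k)
        rw [inv_inv, ← hr] at h1
        refine h1.trans ?_
        rw [mul_div_assoc]
        refine mul_le_mul_of_nonneg_left ?_ (by positivity)
        -- The boundary of a pair has at least 2d - 2 edges rather than 2d; since q ≤ r, the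
        -- denominator q^2 pays for the two missing factors.
        rw [le_div_iff₀ (by positivity)]
        calc r ^ (cutEdges G {u, v} {u, v}ᶜ).card * q ^ 2 ≤ r ^ (2 * d - 2) * r ^ 2 := by
              have := pow_le_pow_of_le_one hr0.le hr1 (card_cutEdges_pair hG huv)
              gcongr
          _ = (r ^ d) ^ 2 := by
              rw [← pow_add, ← pow_mul]
              congr 1
              omega
          _ ≤ _ := by
              have := pow_mix_le hd hq0.le hr0.le hrq
              gcongr
    _ = _ := by
        simp only [Finset.sum_const, card_neighbors hG, Finset.card_univ, nsmul_eq_mul]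
        ring

end FirstRound

/-! ### Components of the high-degree vertices, and the majority cut -/

section Structure

open scoped Classical

variable {V : Type*} [Fintype V]

/-- The neighbours of `v` in `ω`. -/
noncomputable def nbrs (ω : Finset (Sym2 V)) (v : V) : Finset V :=
  Finset.univ.filter fun w => s(v, w) ∈ ω

@[simp] lemma mem_nbrs {ω : Finset (Sym2 V)} {v w : V} : w ∈ nbrs ω v ↔ s(v, w) ∈ ω := by
  simp [nbrs]

lemma mem_nbrs_comm {ω : Finset (Sym2 V)} {v w : V} : w ∈ nbrs ω v ↔ v ∈ nbrs ω w := by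
  simp [Sym2.eq_swap]

/-- The vertices of degree less than `k` in `ω`. -/
noncomputable def lowVerts (ω : Finset (Sym2 V)) (k : ℕ) : Finset V :=
  Finset.univ.filter fun v => (nbrs ω v).card < k

@[simp] lemma mem_lowVerts {ω : Finset (Sym2 V)} {k : ℕ} {v : V} :
    v ∈ lowVerts ω k ↔ (nbrs ω v).card < k := by
  simp [lowVerts]

lemma card_inter_cutEdges_le (G : SimpleGraph V) (ω : Finset (Sym2 V)) (A B : Finset V) :
    (ω ∩ cutEdges G A B).card ≤ ∑ a ∈ A, (nbrs ω a ∩ B).card := by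
  calc (ω ∩ cutEdges G A B).card
      ≤ (A.biUnion fun a => (nbrs ω a ∩ B).image fun b => s(a, b)).card := by
        refine Finset.card_le_card fun e he => ?_
        rw [Finset.mem_inter, mem_cutEdges] at he
        obtain ⟨heω, a, ha, b, hb, _, rfl⟩ := he
        rw [Finset.mem_biUnion]
        exact ⟨a, ha, Finset.mem_image.2 ⟨b, by simp [heω, hb], rfl⟩⟩
    _ ≤ ∑ a ∈ A, ((nbrs ω a ∩ B).image fun b => s(a, b)).card := Finset.card_biUnion_le
    _ ≤ _ := Finset.sum_le_sum fun a _ => Finset.card_image_le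

/-- No nearly isolated connected set of between `2` and `M` vertices, and no two adjacent vertices
of degree less than `k`. -/
structure IsGoodRound (G : SimpleGraph V) (k : ℕ) (M : ℝ) (ω : Finset (Sym2 V)) : Prop where
  subset : ω ⊆ edges G
  not_isNearlyIsolated : ∀ U : Finset V, 2 ≤ U.card → (U.card : ℝ) ≤ M → ¬ IsNearlyIsolated G k ω U
  not_adj_low : ∀ u ∈ lowVerts ω k, ∀ v ∈ lowVerts ω k, ¬ G.Adj u v

lemma isGoodRound_of_not_exists {G : SimpleGraph V} {k : ℕ} {M : ℝ} {ω : Finset (Sym2 V)}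
    (hω : ω ⊆ edges G)
    (h1 : ¬ ∃ U : Finset V, 2 ≤ U.card ∧ (U.card : ℝ) ≤ M ∧ IsNearlyIsolated G k ω U)
    (h2 : ¬ ∃ u v : V, G.Adj u v ∧ (ω ∩ cutEdges G {u, v} {u, v}ᶜ).card ≤ 2 * k) :
    IsGoodRound G k M ω := by
  refine ⟨hω, fun U hU hM h => h1 ⟨U, hU, hM, h⟩, fun u hu v hv huv => h2 ⟨u, v, huv, ?_⟩⟩
  refine (card_inter_cutEdges_le G ω _ _).trans ?_
  rw [Finset.sum_pair huv.ne]
  rw [mem_lowVerts] at hu hv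
  have h3 := Finset.card_le_card (Finset.inter_subset_left (s₁ := nbrs ω u) (s₂ := {u, v}ᶜ))
  have h4 := Finset.card_le_card (Finset.inter_subset_left (s₁ := nbrs ω v) (s₂ := {u, v}ᶜ))
  omega

/-- The vertices outside `X` of degree at least `k` in `ω`. -/
noncomputable def coreVerts (ω : Finset (Sym2 V)) (k : ℕ) (X : Finset V) : Finset V :=
  (lowVerts ω k ∪ X)ᶜ

/-- The vertices outside `X` of degree less than `k` in `ω`. -/
noncomputable def restVerts (ω : Finset (Sym2 V)) (k : ℕ) (X : Finset V) : Finset V :=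
  lowVerts ω k \ X

lemma mem_coreVerts {ω : Finset (Sym2 V)} {k : ℕ} {X : Finset V} {v : V} :
    v ∈ coreVerts ω k X ↔ k ≤ (nbrs ω v).card ∧ v ∉ X := by
  simp [coreVerts]

lemma mem_restVerts {ω : Finset (Sym2 V)} {k : ℕ} {X : Finset V} {v : V} :
    v ∈ restVerts ω k X ↔ (nbrs ω v).card < k ∧ v ∉ X := by
  simp [restVerts]

/-- The graph `ω` restricted to the core vertices. -/
def coreGraph (ω : Finset (Sym2 V)) (k : ℕ) (X : Finset V) : SimpleGraph V where
  Adj u v := u ∈ coreVerts ω k X ∧ v ∈ coreVerts ω k X ∧ (graphOf ω).Adj u v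
  symm := ⟨fun _ _ h => ⟨h.2.1, h.1, h.2.2.symm⟩⟩
  loopless := ⟨fun _ h => (graphOf ω).irrefl h.2.2⟩

/-- The vertex set of the component of `v` in the core graph. -/
noncomputable def coreComp (ω : Finset (Sym2 V)) (k : ℕ) (X : Finset V) (v : V) : Finset V :=
  Finset.univ.filter ((coreGraph ω k X).Reachable v)

/-- The vertex sets of the components of the core graph. -/
noncomputable def coreComps (ω : Finset (Sym2 V)) (k : ℕ) (X : Finset V) : Finset (Finset V) :=
  (coreVerts ω k X).image (coreComp ω k X)

/-- `A` together with the vertices of low degree attached to it. -/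
noncomputable def attach (ω : Finset (Sym2 V)) (k : ℕ) (X A : Finset V) : Finset V :=
  A ∪ (restVerts ω k X).filter fun v => ∃ u ∈ A, u ∈ nbrs ω v

variable {ω : Finset (Sym2 V)} {k : ℕ} {X : Finset V}

lemma mem_coreComp {u v : V} : u ∈ coreComp ω k X v ↔ (coreGraph ω k X).Reachable v u := by
  simp [coreComp]

lemma mem_coreComp_self (v : V) : v ∈ coreComp ω k X v := mem_coreComp.2 (.refl v)

lemma coreComp_eq {u v : V} (h : u ∈ coreComp ω k X v) : coreComp ω k X v = coreComp ω k X u := by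
  ext w
  rw [mem_coreComp] at h
  simp only [mem_coreComp]
  exact ⟨fun h' => h.symm.trans h', fun h' => h.trans h'⟩

lemma coreComp_subset {v : V} (hv : v ∈ coreVerts ω k X) : coreComp ω k X v ⊆ coreVerts ω k X := by
  intro u hu
  exact mem_of_reachable (K := coreGraph ω k X) (U := (coreVerts ω k X : Set V))
    (fun _ _ _ h => h.2.1) hv (mem_coreComp.1 hu)

lemma mem_coreComps {C : Finset V} :
    C ∈ coreComps ω k X ↔ ∃ v ∈ coreVerts ω k X, coreComp ω k X v = C := by
  simp [coreComps]

lemma eq_coreComp_of_mem {C : Finset V} (hC : C ∈ coreComps ω k X) {v : V} (hv : v ∈ C) :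
    C = coreComp ω k X v := by
  obtain ⟨w, _, rfl⟩ := mem_coreComps.1 hC
  exact coreComp_eq hv

lemma subset_coreVerts_of_mem {C : Finset V} (hC : C ∈ coreComps ω k X) : C ⊆ coreVerts ω k X := by
  obtain ⟨w, hw, rfl⟩ := mem_coreComps.1 hC
  exact coreComp_subset hw

lemma card_coreComps_le : (coreComps ω k X).card ≤ Fintype.card V :=
  Finset.card_image_le.trans (Finset.card_le_univ _)

/-- Otherwise this set would be nearly isolated. Every edge leaving it from a core vertex ends in X,
which has fewer than k vertices, and an attached vertex has fewer than k edges altogether. The set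
has at least two vertices because the at least k neighbours of v cannot all lie in X. -/
lemma lt_card_attach {G : SimpleGraph V} {M : ℝ} (h : IsGoodRound G k M ω) (hX : X.card < k)
    {v : V} (hv : v ∈ coreVerts ω k X) : M < (attach ω k X (coreComp ω k X v)).card := by
  set C := coreComp ω k X v with hC
  set C' := attach ω k X C with hC'
  have hCC' : C ⊆ C' := Finset.subset_union_left
  have hvC : v ∈ C := mem_coreComp_self v
  have hnb : ∀ a ∈ C, ∀ w ∈ nbrs ω a, w ∈ C' ∨ w ∈ X := by
    intro a ha w hw
    have haW := coreComp_subset hv ha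
    by_cases hwX : w ∈ X
    · exact Or.inr hwX
    left
    by_cases hwL : (nbrs ω w).card < k
    · refine Finset.mem_union_right _ (Finset.mem_filter.2 ⟨mem_restVerts.2 ⟨hwL, hwX⟩, a, ha, ?_⟩)
      exact mem_nbrs_comm.1 hw
    · refine hCC' (mem_coreComp.2 ((mem_coreComp.1 ha).trans (SimpleGraph.Adj.reachable ?_)))
      exact ⟨haW, mem_coreVerts.2 ⟨not_lt.1 hwL, hwX⟩,
        graphOf_adj_of_mem h.subset (mem_nbrs.1 hw)⟩
  by_contra hlt
  refine h.not_isNearlyIsolated C' ?_ (not_lt.1 hlt) ⟨?_, ?_⟩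
  · have : ∃ w ∈ nbrs ω v, w ∉ X := by
      by_contra hcon
      push Not at hcon
      have := Finset.card_le_card (show nbrs ω v ⊆ X from hcon)
      have := (mem_coreVerts.1 hv).1
      omega
    obtain ⟨w, hw, hwX⟩ := this
    have hwC := (hnb v hvC w hw).resolve_right hwX
    have hne : v ≠ w := (graphOf_adj_of_mem h.subset (mem_nbrs.1 hw)).ne
    exact Finset.one_lt_card.2 ⟨v, hCC' hvC, w, hwC, hne⟩
  · have hvC' : v ∈ (C' : Set V) := hCC' hvC
    have key : ∀ w ∈ C, ∃ hw : w ∈ (C' : Set V),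
        ((graphOf ω).induce (C' : Set V)).Reachable ⟨v, hvC'⟩ ⟨w, hw⟩ := by
      intro w hw
      refine (mem_of_reachable (U := {w | w ∈ C ∧ ∃ hw : w ∈ (C' : Set V),
        ((graphOf ω).induce (C' : Set V)).Reachable ⟨v, hvC'⟩ ⟨w, hw⟩}) ?_
        ⟨hvC, hvC', .refl _⟩ (mem_coreComp.1 hw)).2
      rintro a ⟨haC, haC', hr⟩ b hab
      have hbC : b ∈ C := mem_coreComp.2 ((mem_coreComp.1 haC).trans hab.reachable)
      refine ⟨hbC, hCC' hbC, hr.trans (SimpleGraph.Adj.reachable ?_)⟩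
      exact hab.2.2
    have key2 : ∀ w : (C' : Set V),
        ((graphOf ω).induce (C' : Set V)).Reachable ⟨v, hvC'⟩ w := by
      rintro ⟨w, hw⟩
      rcases Finset.mem_union.1 (show w ∈ C ∪ _ from hw) with hwC | hwR
      · exact (key w hwC).2
      · obtain ⟨-, u, hu, huw⟩ := Finset.mem_filter.1 hwR
        obtain ⟨hu', hr⟩ := key u hu
        refine hr.trans (SimpleGraph.Adj.reachable ?_)
        exact (graphOf_adj_of_mem h.subset (mem_nbrs.1 huw)).symm
    have : Nonempty (C' : Set V) := ⟨⟨v, hvC'⟩⟩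
    exact ⟨fun a b => (key2 a).symm.trans (key2 b)⟩
  · refine (card_inter_cutEdges_le G ω _ _).trans ?_
    rw [mul_comm, ← smul_eq_mul]
    refine Finset.sum_le_card_nsmul _ _ _ fun a ha => ?_
    rcases Finset.mem_union.1 (show a ∈ C ∪ _ from ha) with haC | haR
    · have : nbrs ω a ∩ C'ᶜ ⊆ X := by
        intro w hw
        rw [Finset.mem_inter, Finset.mem_compl] at hw
        exact (hnb a haC w hw.1).resolve_left hw.2
      exact (Finset.card_le_card this).trans hX.le
    · have := (mem_restVerts.1 (Finset.mem_filter.1 haR).1).1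
      exact (Finset.card_le_card Finset.inter_subset_left).trans this.le

/-- A union of components of the core graph together with the attached low vertices is large. -/
lemma card_mul_le_card_attach {G : SimpleGraph V} {M : ℝ} (h : IsGoodRound G k M ω)
    (hX : X.card < k) {J : Finset (Finset V)} (hJ : J ⊆ coreComps ω k X) :
    J.card * M ≤ k * (attach ω k X (J.biUnion id)).card := by
  set A' := attach ω k X (J.biUnion id) with hA'
  have hsub : ∀ C ∈ J, attach ω k X C ⊆ A' := by
    intro C hC v hv
    rcases Finset.mem_union.1 hv with hv | hv
    · exact Finset.mem_union_left _ (Finset.mem_biUnion.2 ⟨C, hC, hv⟩)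
    · obtain ⟨hvR, u, hu, huv⟩ := Finset.mem_filter.1 hv
      exact Finset.mem_union_right _
        (Finset.mem_filter.2 ⟨hvR, u, Finset.mem_biUnion.2 ⟨C, hC, hu⟩, huv⟩)
  -- Double counting: a low vertex is attached to at most one component per neighbour, hence to
  -- fewer than k of them, and a core vertex lies only in its own.
  have hmult : ∀ v ∈ A', (J.filter fun C => v ∈ attach ω k X C).card ≤ k := by
    intro v hv
    by_cases hvR : v ∈ restVerts ω k X
    · have hs : (J.filter fun C => v ∈ attach ω k X C) ⊆ (nbrs ω v).image (coreComp ω k X) := by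
        intro C hC
        rw [Finset.mem_filter] at hC
        rcases Finset.mem_union.1 hC.2 with hvC | hvC
        · have h1 := mem_coreVerts.1 (subset_coreVerts_of_mem (hJ hC.1) hvC)
          have h2 := mem_restVerts.1 hvR
          omega
        · obtain ⟨-, u, hu, huv⟩ := Finset.mem_filter.1 hvC
          exact Finset.mem_image.2 ⟨u, huv, (eq_coreComp_of_mem (hJ hC.1) hu).symm⟩
      exact (Finset.card_le_card hs).trans (Finset.card_image_le.trans (mem_restVerts.1 hvR).1.le)
    · have hs : (J.filter fun C => v ∈ attach ω k X C) ⊆ {coreComp ω k X v} := by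
        intro C hC
        rw [Finset.mem_filter] at hC
        rcases Finset.mem_union.1 hC.2 with hvC | hvC
        · exact Finset.mem_singleton.2 (eq_coreComp_of_mem (hJ hC.1) hvC)
        · exact absurd (Finset.mem_filter.1 hvC).1 hvR
      have := Finset.card_le_card hs
      rw [Finset.card_singleton] at this
      omega
  have hcount : ∑ C ∈ J, (attach ω k X C).card ≤ k * A'.card := by
    calc ∑ C ∈ J, (attach ω k X C).card
        = ∑ C ∈ J, ∑ v ∈ A', if v ∈ attach ω k X C then 1 else 0 := by
          refine Finset.sum_congr rfl fun C hC => ?_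
          rw [← Finset.card_filter, Finset.filter_mem_eq_inter,
            Finset.inter_eq_right.2 (hsub C hC)]
      _ = ∑ v ∈ A', (J.filter fun C => v ∈ attach ω k X C).card := by
          rw [Finset.sum_comm]
          simp only [Finset.card_filter]
      _ ≤ k * A'.card := by
          rw [mul_comm, ← smul_eq_mul]
          exact Finset.sum_le_card_nsmul _ _ _ hmult
  have hM : J.card * M ≤ ∑ C ∈ J, ((attach ω k X C).card : ℝ) := by
    rw [← nsmul_eq_mul]
    refine Finset.card_nsmul_le_sum _ _ _ fun C hC => ?_
    obtain ⟨v, hv, rfl⟩ := mem_coreComps.1 (hJ hC)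
    exact (lt_card_attach h hX hv).le
  refine hM.trans ?_
  exact_mod_cast hcount

/-- The number of edges between `A` and `B` when every vertex of `R` joins the side in which it has
more neighbours. -/
noncomputable def majorityCut (G : SimpleGraph V) (A B R : Finset V) : ℕ :=
  (G.interedges A B).card
    + ∑ v ∈ R, min (A.filter (G.Adj v)).card (B.filter (G.Adj v)).card

lemma card_interedges_swap (G : SimpleGraph V) (A B : Finset V) :
    (G.interedges A B).card = (G.interedges B A).card :=
  have : Std.Symm G.Adj := G.symm
  Rel.card_interedges_comm A B

lemma majorityCut_comm (G : SimpleGraph V) (A B R : Finset V) :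
    majorityCut G A B R = majorityCut G B A R := by
  rw [majorityCut, majorityCut]
  congr 1
  · exact card_interedges_swap G A B
  · exact Finset.sum_congr rfl fun v _ => min_comm _ _

lemma edgeBoundaryCard_compl (G : SimpleGraph V) (U : Finset V) :
    edgeBoundaryCard G Uᶜ = edgeBoundaryCard G U := by
  rw [edgeBoundaryCard, edgeBoundaryCard, compl_compl]
  exact card_interedges_swap G _ _

/-- As R is independent, an edge leaving `A ∪ RA` runs between A and B, between A and `RB`, between
`RA` and B, or ends in X. The majority rule turns the second and third kinds into the sum of minima;
X accounts for at most kd edges. -/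
lemma edgeBoundaryCard_majority_le {G : SimpleGraph V} {d : ℕ} (hG : IsRegular G d)
    {A B R RA RB : Finset V} (hR : ∀ u ∈ R, ∀ v ∈ R, ¬ G.Adj u v)
    (hcov : A ∪ B ∪ R ∪ X = Finset.univ) (hX : X.card ≤ k)
    (hRA : RA = R.filter fun v => (B.filter (G.Adj v)).card ≤ (A.filter (G.Adj v)).card)
    (hRB : RB = R.filter fun v => ¬ (B.filter (G.Adj v)).card ≤ (A.filter (G.Adj v)).card) :
    edgeBoundaryCard G (A ∪ RA) ≤ majorityCut G A B R + k * d := by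
  have hsub : G.interedges (A ∪ RA) (A ∪ RA)ᶜ ⊆
      G.interedges A B ∪ G.interedges A RB ∪ G.interedges RA B
        ∪ G.interedges Finset.univ X := by
    rintro ⟨u, v⟩ huv
    simp only [Finset.mem_union, SimpleGraph.mem_interedges_iff, Finset.mem_compl,
      Finset.mem_univ, true_and] at huv ⊢
    have hv : v ∈ A ∪ B ∪ R ∪ X := hcov ▸ Finset.mem_univ v
    simp only [Finset.mem_union] at hv
    have := hR u
    grind
  have h1 : (G.interedges A RB).card = ∑ v ∈ RB, (A.filter (G.Adj v)).card := by
    rw [← card_interedges_eq_sum]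
    exact card_interedges_swap G _ _
  have h2 := card_interedges_eq_sum G RA B
  have h3 : (G.interedges Finset.univ X).card ≤ k * d := by
    calc (G.interedges Finset.univ X).card = (G.interedges X Finset.univ).card :=
          card_interedges_swap G _ _
      _ ≤ d * X.card := card_interedges_le hG _ _
      _ ≤ k * d := by rw [mul_comm]; gcongr
  have h4 : ∑ v ∈ R, min (A.filter (G.Adj v)).card (B.filter (G.Adj v)).card
      = ∑ v ∈ RA, (B.filter (G.Adj v)).card + ∑ v ∈ RB, (A.filter (G.Adj v)).card := by
    rw [hRA, hRB, ← Finset.sum_filter_add_sum_filter_not R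
      (fun v => (B.filter (G.Adj v)).card ≤ (A.filter (G.Adj v)).card)]
    congr 1
    · exact Finset.sum_congr rfl fun v hv => min_eq_right (Finset.mem_filter.1 hv).2
    · exact Finset.sum_congr rfl fun v hv => min_eq_left (not_le.1 (Finset.mem_filter.1 hv).2).le
  have h5 := (Finset.card_le_card hsub).trans ((Finset.card_union_le _ _).trans
    (Nat.add_le_add_right ((Finset.card_union_le _ _).trans
      (Nat.add_le_add_right (Finset.card_union_le _ _) _)) _))
  have h6 : edgeBoundaryCard G (A ∪ RA) = (G.interedges (A ∪ RA) (A ∪ RA)ᶜ).card := rfl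
  rw [majorityCut, h4]
  omega

/-- A vertex of A' that the majority rule puts on the other side still has a neighbour in A, so its
minimum in the cut is at least 1 and pays for it. -/
lemma card_le_card_majority_add {G : SimpleGraph V} {A B R RA A' : Finset V}
    (hRA : ∀ v ∈ R, v ∉ RA → (A.filter (G.Adj v)).card ≤ (B.filter (G.Adj v)).card)
    (hA' : ∀ v ∈ A', v ∈ A ∨ v ∈ R ∧ ∃ u ∈ A, G.Adj v u) :
    A'.card ≤ (A ∪ RA).card + majorityCut G A B R := by
  have hsub : A' ⊆ (A ∪ RA) ∪ (R.filter fun v => v ∉ RA ∧ ∃ u ∈ A, G.Adj v u) := by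
    intro v hv
    have := hA' v hv
    simp only [Finset.mem_union, Finset.mem_filter]
    tauto
  refine (Finset.card_le_card hsub).trans ((Finset.card_union_le _ _).trans ?_)
  gcongr
  rw [Finset.card_filter]
  refine (Finset.sum_le_sum fun v hv => ?_).trans (Nat.le_add_left _ _)
  split_ifs with h
  · obtain ⟨h1, u, hu, huv⟩ := h
    have h2 := hRA v hv h1
    rw [min_eq_left h2]
    exact Finset.card_pos.2 ⟨u, Finset.mem_filter.2 ⟨hu, huv⟩⟩
  · exact Nat.zero_le _

/-- Global expansion forces many edges in the majority cut. -/
lemma le_majorityCut {G : SimpleGraph V} {d : ℕ} (hG : IsRegular G d) {c : ℝ} (hc : 0 < c)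
    (hglob : GlobalExpansion G c) {A B R A' B' : Finset V}
    (hR : ∀ u ∈ R, ∀ v ∈ R, ¬ G.Adj u v)
    (hcov : A ∪ B ∪ R ∪ X = Finset.univ) (hAB : Disjoint A B) (hAR : Disjoint A R)
    (hBR : Disjoint B R) (hX : X.card ≤ k)
    (hA' : ∀ v ∈ A', v ∈ A ∨ v ∈ R ∧ ∃ u ∈ A, G.Adj v u)
    (hB' : ∀ v ∈ B', v ∈ B ∨ v ∈ R ∧ ∃ u ∈ B, G.Adj v u)
    {t : ℝ} (htA : t ≤ A'.card) (htB : t ≤ B'.card) :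
    min c 1 * t ≤ 2 * majorityCut G A B R + k * d := by
  obtain ⟨RA, hRA⟩ : ∃ S, S = R.filter fun v =>
    (B.filter (G.Adj v)).card ≤ (A.filter (G.Adj v)).card := ⟨_, rfl⟩
  obtain ⟨RB, hRB⟩ : ∃ S, S = R.filter fun v =>
    ¬ (B.filter (G.Adj v)).card ≤ (A.filter (G.Adj v)).card := ⟨_, rfl⟩
  have hbd := edgeBoundaryCard_majority_le hG hR hcov hX hRA hRB
  have h1 : A'.card ≤ (A ∪ RA).card + majorityCut G A B R := by
    refine card_le_card_majority_add (fun v hv hv' => ?_) hA'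
    simp only [hRA, Finset.mem_filter, not_and, not_le] at hv'
    exact (hv' hv).le
  have h2 : B'.card ≤ (B ∪ RB).card + majorityCut G A B R := by
    rw [majorityCut_comm]
    refine card_le_card_majority_add (fun v hv hv' => ?_) hB'
    simp only [hRB, Finset.mem_filter, not_and, not_not] at hv'
    exact hv' hv
  have hsub : B ∪ RB ⊆ (A ∪ RA)ᶜ := by
    intro v hv
    rw [Finset.disjoint_left] at hAB hAR hBR
    simp only [hRA, hRB, Finset.mem_union, Finset.mem_filter, Finset.mem_compl] at hv ⊢
    grind
  have h3 := Finset.card_le_card hsub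
  have h4 := Finset.card_add_card_compl (A ∪ RA)
  have hm0 : 0 < min c 1 := lt_min hc one_pos
  set D := majorityCut G A B R with hD
  have hbd' : (edgeBoundaryCard G (A ∪ RA) : ℝ) ≤ D + k * d := by exact_mod_cast hbd
  -- U will be whichever of `A ∪ RA` and its complement has at most half of the vertices. The cut D
  -- is spent twice, on the boundary of U and on the vertices missing from U; the constant `min c 1`
  -- makes both charges at most D.
  have fin : ∀ U : Finset V, (U.card : ℝ) ≤ (Fintype.card V : ℝ) / 2 →
      (edgeBoundaryCard G U : ℝ) ≤ D + k * d → t ≤ U.card + D → min c 1 * t ≤ 2 * D + k * d := by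
    intro U hU hb ht
    have h5 := hglob U hU
    calc min c 1 * t ≤ min c 1 * (U.card + D) := by gcongr
      _ = min c 1 * U.card + min c 1 * D := by ring
      _ ≤ c * U.card + 1 * D := by
          gcongr
          · exact min_le_left _ _
          · exact min_le_right _ _
      _ ≤ 2 * D + k * d := by linarith
  by_cases hhalf : ((A ∪ RA).card : ℝ) ≤ (Fintype.card V : ℝ) / 2
  · refine fin _ hhalf hbd' (htA.trans ?_)
    exact_mod_cast h1
  · refine fin (A ∪ RA)ᶜ ?_ ?_ (htB.trans ?_)
    · have : ((A ∪ RA).card : ℝ) + ((A ∪ RA)ᶜ.card : ℝ) = Fintype.card V := by exact_mod_cast h4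
      linarith
    · rw [edgeBoundaryCard_compl]
      exact hbd'
    · have : B'.card ≤ (A ∪ RA)ᶜ.card + D := by omega
      exact_mod_cast this

end Structure

/-! ### Second round: probability that two families of components stay separated -/

section SecondRound

open scoped Classical

variable {V : Type*} [Fintype V]

/-- No edge of `ω` joins `A` to `B`, and no vertex of `R` sends at least one edge of `ω` to one of
these sets and at least `k` to the other. -/
def IsSeparated (G : SimpleGraph V) (k : ℕ) (A B R : Finset V) (ω : Finset (Sym2 V)) : Prop :=
  ω ∩ cutEdges G A B = ∅ ∧ ∀ v ∈ R,
    ¬ (1 ≤ (ω ∩ cutEdges G {v} A).card ∧ k ≤ (ω ∩ cutEdges G {v} B).card) ∧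
    ¬ (1 ≤ (ω ∩ cutEdges G {v} B).card ∧ k ≤ (ω ∩ cutEdges G {v} A).card)

lemma exists_adj_of_card_pos {G : SimpleGraph V} {ω : Finset (Sym2 V)} {v : V} {A : Finset V}
    (h : 1 ≤ (ω ∩ cutEdges G {v} A).card) : ∃ a ∈ A, s(v, a) ∈ ω := by
  obtain ⟨e, he⟩ := Finset.card_pos.1 h
  rw [Finset.mem_inter, mem_cutEdges] at he
  obtain ⟨heω, a, ha, b, hb, -, rfl⟩ := he
  rw [Finset.mem_singleton] at ha
  exact ⟨b, hb, ha ▸ heω⟩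

lemma le_card_nbrs_of_le {G : SimpleGraph V} {ω ω' : Finset (Sym2 V)} (hω : ω ⊆ ω') {k : ℕ} {v : V}
    {A : Finset V} (h : k ≤ (ω ∩ cutEdges G {v} A).card) : k ≤ (nbrs ω' v).card := by
  refine h.trans ((card_inter_cutEdges_le G ω _ _).trans ?_)
  rw [Finset.sum_singleton]
  refine Finset.card_le_card fun w hw => ?_
  rw [Finset.mem_inter, mem_nbrs] at hw
  exact mem_nbrs.2 (hω hw.1)

/-- If the core of the union of both rounds is disconnected by `X`, then the second round separates
two unions of components of the first round. -/
lemma exists_isSeparated {G : SimpleGraph V} {k : ℕ} (hk : 1 ≤ k) {M : ℝ} {ω₁ ω₂ : Finset (Sym2 V)}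
    (h : IsGoodRound G k M ω₁) (h₂ : ω₂ ⊆ edges G) {X : Finset V} (hX : X.card < k) {S : Set V}
    (hS : S = {v | v ∈ coreVerts (ω₁ ∪ ω₂) k X}) (hne : S.Nonempty)
    (hdis : ¬ ((graphOf (ω₁ ∪ ω₂)).induce S).Connected) :
    ∃ J ∈ (coreComps ω₁ k X).powerset, (J ≠ ∅ ∧ J ≠ coreComps ω₁ k X) ∧
      IsSeparated G k (J.biUnion id) ((coreComps ω₁ k X \ J).biUnion id) (restVerts ω₁ k X) ω₂ := by
  have hω : ω₁ ∪ ω₂ ⊆ edges G := Finset.union_subset h.subset h₂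
  have : Nonempty S := hne.to_subtype
  have : ∃ u v : S, ¬ ((graphOf (ω₁ ∪ ω₂)).induce S).Reachable u v := by
    by_contra hcon
    push Not at hcon
    exact hdis ⟨hcon⟩
  obtain ⟨⟨u, hu⟩, ⟨v, hv⟩, huv⟩ := this
  set A : Set V := {w | ∃ hw : w ∈ S, ((graphOf (ω₁ ∪ ω₂)).induce S).Reachable ⟨u, hu⟩ ⟨w, hw⟩}
    with hA
  have huA : u ∈ A := ⟨hu, .refl _⟩
  have hvA : v ∉ A := fun ⟨_, h'⟩ => huv h'
  have hclosed : ∀ a ∈ A, ∀ b ∈ S, s(a, b) ∈ ω₁ ∪ ω₂ → b ∈ A := by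
    rintro a ⟨haS, hr⟩ b hb hab
    exact ⟨hb, hr.trans (SimpleGraph.Adj.reachable (graphOf_adj_of_mem hω hab))⟩
  have hsubS : ∀ w ∈ coreVerts ω₁ k X, w ∈ S := by
    intro w hw
    rw [mem_coreVerts] at hw
    rw [hS]
    refine mem_coreVerts.2 ⟨hw.1.trans (Finset.card_le_card fun x hx => ?_), hw.2⟩
    rw [mem_nbrs] at hx ⊢
    exact Finset.mem_union_left _ hx
  have hcomp : ∀ w ∈ coreVerts ω₁ k X, w ∈ A → ∀ x ∈ coreComp ω₁ k X w, x ∈ A := by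
    intro w hw hwA x hx
    refine mem_of_reachable (K := coreGraph ω₁ k X) ?_ hwA (mem_coreComp.1 hx)
    intro a ha b hab
    exact hclosed a ha b (hsubS b hab.2.1) (Finset.mem_union_left _ (by simpa using hab.2.2.1))
  -- A vertex low in the first round but now of degree at least k has a neighbour outside X, which
  -- is not low because low vertices are independent. So each side of the disconnection meets, and
  -- hence contains, a first-round component.
  have hattach : ∀ w ∈ S, ∃ x ∈ coreVerts ω₁ k X, w = x ∨ s(w, x) ∈ ω₁ ∪ ω₂ := by
    intro w hw
    have hwS := hw
    rw [hS] at hwS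
    have hwS := mem_coreVerts.1 hwS
    by_cases hlow : (nbrs ω₁ w).card < k
    · have : ∃ x ∈ nbrs (ω₁ ∪ ω₂) w, x ∉ X := by
        by_contra hcon
        push Not at hcon
        have := Finset.card_le_card (show nbrs (ω₁ ∪ ω₂) w ⊆ X from hcon)
        omega
      obtain ⟨x, hx, hxX⟩ := this
      rw [mem_nbrs] at hx
      refine ⟨x, mem_coreVerts.2 ⟨?_, hxX⟩, Or.inr hx⟩
      by_contra hlt
      have hadj : G.Adj w x := by simpa using hω hx
      exact h.not_adj_low w (by simpa using hlow) x (by simpa using hlt) hadj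
    · exact ⟨w, mem_coreVerts.2 ⟨not_lt.1 hlow, hwS.2⟩, Or.inl rfl⟩
  set J := (coreComps ω₁ k X).filter fun C : Finset V => (C : Set V) ⊆ A with hJ
  have hJA : ∀ x ∈ J.biUnion id, x ∈ A := by
    intro x hx
    obtain ⟨C, hC, hxC⟩ := Finset.mem_biUnion.1 hx
    exact (Finset.mem_filter.1 hC).2 hxC
  have hJB : ∀ x ∈ (coreComps ω₁ k X \ J).biUnion id, x ∈ S ∧ x ∉ A := by
    intro x hx
    obtain ⟨C, hC, hxC⟩ := Finset.mem_biUnion.1 hx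
    rw [Finset.mem_sdiff] at hC
    have hxW := subset_coreVerts_of_mem hC.1 hxC
    refine ⟨hsubS x hxW, fun hxA => hC.2 (Finset.mem_filter.2 ⟨hC.1, ?_⟩)⟩
    rw [eq_coreComp_of_mem hC.1 hxC]
    exact hcomp x hxW hxA
  refine ⟨J, Finset.mem_powerset.2 (Finset.filter_subset _ _), ⟨?_, ?_⟩, ?_, ?_⟩
  · obtain ⟨x, hxW, hx⟩ := hattach u hu
    have hxA : x ∈ A := by
      rcases hx with rfl | hx
      · exact huA
      · exact hclosed u huA x (hsubS x hxW) hx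
    refine Finset.Nonempty.ne_empty ⟨coreComp ω₁ k X x, Finset.mem_filter.2 ⟨?_, ?_⟩⟩
    · exact mem_coreComps.2 ⟨x, hxW, rfl⟩
    · exact hcomp x hxW hxA
  · obtain ⟨x, hxW, hx⟩ := hattach v hv
    have hxA : x ∉ A := by
      rcases hx with rfl | hx
      · exact hvA
      · exact fun hxA => hvA (hclosed x hxA v hv (by rwa [Sym2.eq_swap]))
    intro hJe
    have : coreComp ω₁ k X x ∈ J := by
      rw [hJe]
      exact mem_coreComps.2 ⟨x, hxW, rfl⟩
    exact hxA ((Finset.mem_filter.1 this).2 (mem_coreComp_self x))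
  · rw [Finset.eq_empty_iff_forall_notMem]
    intro e he
    rw [Finset.mem_inter, mem_cutEdges] at he
    obtain ⟨heω, a, ha, b, hb, -, rfl⟩ := he
    exact (hJB b hb).2 (hclosed a (hJA a ha) b (hJB b hb).1 (Finset.mem_union_right _ heω))
  · intro x hx
    have hxX := (mem_restVerts.1 hx).2
    -- A low vertex whose degree reaches k enters the new core, where edges to both sides would
    -- connect them.
    have fin : ∀ a ∈ J.biUnion id, ∀ b ∈ (coreComps ω₁ k X \ J).biUnion id,
        s(x, a) ∈ ω₂ → s(x, b) ∈ ω₂ → ¬ k ≤ (nbrs (ω₁ ∪ ω₂) x).card := by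
      intro a ha b hb hxa hxb hdeg
      have hxS : x ∈ S := by
        rw [hS]
        exact mem_coreVerts.2 ⟨hdeg, hxX⟩
      have hxA := hclosed a (hJA a ha) x hxS (Finset.mem_union_right _ (by rwa [Sym2.eq_swap]))
      exact (hJB b hb).2 (hclosed x hxA b (hJB b hb).1 (Finset.mem_union_right _ hxb))
    constructor
    · rintro ⟨h1, h2⟩
      obtain ⟨a, ha, hxa⟩ := exists_adj_of_card_pos h1
      obtain ⟨b, hb, hxb⟩ := exists_adj_of_card_pos (hk.trans h2)
      exact fin a ha b hb hxa hxb (le_card_nbrs_of_le Finset.subset_union_right h2)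
    · rintro ⟨h1, h2⟩
      obtain ⟨b, hb, hxb⟩ := exists_adj_of_card_pos h1
      obtain ⟨a, ha, hxa⟩ := exists_adj_of_card_pos (hk.trans h2)
      exact fin a ha b hb hxa hxb (le_card_nbrs_of_le Finset.subset_union_right h2)

lemma card_cutEdges_singleton (G : SimpleGraph V) {v : V} {A : Finset V} (hv : v ∉ A) :
    (cutEdges G {v} A).card = (A.filter (G.Adj v)).card := by
  rw [card_cutEdges (by simpa using hv), card_interedges_eq_sum, Finset.sum_singleton]

lemma bernProb_mul_inter {α : Type*} [DecidableEq α] {E F₁ F₂ : Finset α} (h₁ : F₁ ⊆ E)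
    (h₂ : F₂ ⊆ E) (hd : Disjoint F₁ F₂) (p : ℝ) (A₁ A₂ : Finset α → Prop) :
    bernProb E p (fun ω => A₁ (ω ∩ F₁) ∧ A₂ (ω ∩ F₂)) = bernProb F₁ p A₁ * bernProb F₂ p A₂ := by
  simp only [bernProb]
  rw [← bernExp_mul_inter h₁ h₂ hd]
  refine bernExp_congr fun ω _ => ?_
  split_ifs <;> simp_all

lemma bernProb_eq_empty {α : Type*} [DecidableEq α] (F : Finset α) (p : ℝ) :
    bernProb F p (fun ω => ω = ∅) = (1 - p) ^ F.card := by
  have := bernProb_inter_eq (Finset.Subset.refl F) (Finset.empty_subset F) p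
  rw [bernProb_inter subset_rfl p (· = ∅)] at this
  simpa using this

/-- Lower bound for a vertex to be joined to both of two sets of potential neighbours. -/
lemma le_bernProb_cross {α : Type*} [DecidableEq α] {E Fa Fb : Finset α} (ha : Fa ⊆ E)
    (hb : Fb ⊆ E) (hdisj : Disjoint Fa Fb) {d k : ℕ} (hd : 6 * (k + 1) ≤ d) (had : Fa.card ≤ d)
    (hbd : d ≤ 3 * Fb.card) :
    (Fa.card : ℝ) / (4 * d) ≤ bernProb E (6 * (k + 1) / d)
      (fun ω => 1 ≤ (ω ∩ Fa).card ∧ k ≤ (ω ∩ Fb).card) := by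
  have hd0 : (0 : ℝ) < d := by
    have : 0 < d := by omega
    exact_mod_cast this
  have hdk : 6 * ((k : ℝ) + 1) ≤ d := by exact_mod_cast hd
  set p : ℝ := 6 * (k + 1) / d with hp
  have hp0 : 0 ≤ p := by positivity
  have hp1 : p ≤ 1 := (div_le_one hd0).2 hdk
  rw [bernProb_mul_inter ha hb hdisj p (fun ω => 1 ≤ ω.card) (fun ω => k ≤ ω.card)]
  -- Already density 1/d would do: for z = |Fa|/d ≤ 1, the probability of an edge is at least 1 -
  -- exp(-z) ≥ z/2.
  have h1 : (Fa.card : ℝ) / (2 * d) ≤ bernProb Fa p (fun ω => 1 ≤ ω.card) := by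
    have e1 : bernProb Fa p (fun ω => 1 ≤ ω.card) = 1 - (1 - p) ^ Fa.card := by
      rw [← bernProb_eq_empty, ← bernProb_not]
      congr 1
      ext ω
      rw [Nat.one_le_iff_ne_zero, Ne, Finset.card_eq_zero]
    rw [e1]
    set z : ℝ := (Fa.card : ℝ) / d with hz
    have hz0 : 0 ≤ z := by positivity
    have hz1 : z ≤ 1 := (div_le_one hd0).2 (by exact_mod_cast had)
    have h2 : (1 - p) ^ Fa.card ≤ Real.exp (-z) := by
      calc (1 - p) ^ Fa.card ≤ (Real.exp (-(1 / d))) ^ Fa.card := by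
            refine pow_le_pow_left₀ (by linarith) ?_ _
            have h3 := Real.add_one_le_exp (-(1 / d : ℝ))
            have h4 : 1 / (d : ℝ) ≤ p := by
              rw [hp]
              gcongr
              have : (0 : ℝ) ≤ k := Nat.cast_nonneg k
              linarith
            linarith
        _ = Real.exp (-z) := by
            rw [← Real.exp_nat_mul, hz]
            congr 1
            ring
    have h3 : Real.exp (-z) ≤ 1 - z / 2 := by
      have h4 := Real.add_one_le_exp z
      rw [Real.exp_neg, inv_le_comm₀ (Real.exp_pos z) (by linarith)]
      refine le_trans ?_ h4
      rw [inv_le_iff_one_le_mul₀ (by linarith)]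
      nlinarith
    have e2 : (Fa.card : ℝ) / (2 * d) = z / 2 := by rw [hz]; field_simp
    rw [e2]
    linarith
  -- The density 6(k+1)/d is chosen for this: |Fb| ≥ d/3 gives mean at least 2(k+1), and the lower
  -- tail is at most 2^k exp(-(k+1)) ≤ 1/2.
  have h2 : (1 / 2 : ℝ) ≤ bernProb Fb p (fun ω => k ≤ ω.card) := by
    have h3 : bernProb Fb p (fun ω => ¬ k ≤ ω.card) ≤ 1 / 2 := by
      have h4 := bernProb_card_inter_le (p := p) (Finset.Subset.refl Fb) hp0 hp1
        (x := 1 / 2) (by norm_num) (by norm_num) k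
      refine (bernProb_mono hp0 hp1 fun ω _ hω => ?_).trans (h4.trans ?_)
      · exact (Finset.card_le_card Finset.inter_subset_left).trans (not_le.1 hω).le
      · have h5 : (1 - p + p * (1 / 2)) ^ Fb.card ≤ Real.exp (-(k + 1)) := by
          calc (1 - p + p * (1 / 2)) ^ Fb.card ≤ (Real.exp (-(p / 2))) ^ Fb.card := by
                refine pow_le_pow_left₀ (by linarith) ?_ _
                have := Real.add_one_le_exp (-(p / 2))
                linarith
            _ ≤ Real.exp (-(k + 1)) := by
                rw [← Real.exp_nat_mul, Real.exp_le_exp, hp]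
                have h6 : (d : ℝ) ≤ 3 * Fb.card := by exact_mod_cast hbd
                rw [mul_neg, neg_le_neg_iff, div_div, mul_div_assoc', le_div_iff₀ (by positivity)]
                nlinarith
        have h6 : (2 : ℝ) ^ (k + 1) ≤ Real.exp (k + 1) := by
          have h7 : (2 : ℝ) ≤ Real.exp 1 := by
            have := Real.add_one_le_exp (1 : ℝ)
            linarith
          calc (2 : ℝ) ^ (k + 1) ≤ Real.exp 1 ^ (k + 1) := by gcongr
            _ = Real.exp (k + 1) := by
                rw [← Real.exp_nat_mul]
                push_cast
                ring_nf
        calc ((1 / 2 : ℝ)⁻¹) ^ k * (1 - p + p * (1 / 2)) ^ Fb.card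
            ≤ 2 ^ k * Real.exp (-(k + 1)) := by
              rw [one_div, inv_inv]
              rw [one_div] at h5
              gcongr
          _ ≤ 1 / 2 := by
              rw [Real.exp_neg, ← div_eq_mul_inv, div_le_div_iff₀ (Real.exp_pos _) (by norm_num),
                one_mul, ← pow_succ]
              exact h6
    rw [bernProb_not] at h3
    linarith
  calc (Fa.card : ℝ) / (4 * d) = (Fa.card : ℝ) / (2 * d) * (1 / 2) := by field_simp; ring
    _ ≤ _ := by
        gcongr
        exact bernProb_nonneg hp0 hp1 _

lemma disjoint_cutEdges_singleton (G : SimpleGraph V) {v : V} {A B : Finset V} (hvA : v ∉ A)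
    (hAB : Disjoint A B) : Disjoint (cutEdges G {v} A) (cutEdges G {v} B) := by
  rw [Finset.disjoint_left] at hAB ⊢
  intro e he he'
  obtain ⟨a, ha, b, hb, _, rfl⟩ := mem_cutEdges.1 he
  obtain ⟨a', ha', b', hb', _, heq⟩ := mem_cutEdges.1 he'
  simp only [Finset.mem_singleton] at ha ha'
  rw [Sym2.eq_iff] at heq
  grind

/-- The probability that the second round separates `A` from `B`. -/
lemma bernProb_isSeparated_le {G : SimpleGraph V} {d k : ℕ} (hG : IsRegular G d)
    (hd : 6 * (k + 1) ≤ d) {A B R : Finset V} (hAB : Disjoint A B) (hAR : Disjoint A R)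
    (hBR : Disjoint B R)
    (hdeg : ∀ v ∈ R, d ≤ (A.filter (G.Adj v)).card + (B.filter (G.Adj v)).card + k) :
    bernProb (edges G) (6 * (k + 1) / d) (IsSeparated G k A B R)
      ≤ Real.exp (-(majorityCut G A B R / (4 * d))) := by
  have hd0 : (0 : ℝ) < d := by
    have : 0 < d := by omega
    exact_mod_cast this
  have hdk : 6 * ((k : ℝ) + 1) ≤ d := by exact_mod_cast hd
  set p : ℝ := 6 * (k + 1) / d with hp
  have hp0 : 0 ≤ p := by positivity
  have hp1 : p ≤ 1 := (div_le_one hd0).2 hdk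
  set F : V → Finset (Sym2 V) := fun v => cutEdges G {v} (A ∪ B) with hF
  have hFA : ∀ v, cutEdges G {v} A ⊆ F v := fun v e he => by
    obtain ⟨a, ha, b, hb, h, rfl⟩ := mem_cutEdges.1 he
    exact mk_mem_cutEdges ha (Finset.mem_union_left _ hb) h
  have hFB : ∀ v, cutEdges G {v} B ⊆ F v := fun v e he => by
    obtain ⟨a, ha, b, hb, h, rfl⟩ := mem_cutEdges.1 he
    exact mk_mem_cutEdges ha (Finset.mem_union_right _ hb) h
  have hFE : ∀ v, F v ⊆ edges G := fun v => cutEdges_subset _ _ _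
  have hvA : ∀ v ∈ R, v ∉ A := fun v hv h => Finset.disjoint_left.1 hAR h hv
  have hvB : ∀ v ∈ R, v ∉ B := fun v hv h => Finset.disjoint_left.1 hBR h hv
  -- Vertices of R lie outside A ∪ B, so their edges to A ∪ B are distinct for distinct vertices and
  -- disjoint from the A–B edges. The separation probability therefore factorises.
  have hdF : (R : Set V).PairwiseDisjoint F := by
    intro u hu v hv huv
    rw [Function.onFun, Finset.disjoint_left]
    intro e he he'
    obtain ⟨a, ha, b, hb, _, rfl⟩ := mem_cutEdges.1 he
    obtain ⟨a', ha', b', hb', _, heq⟩ := mem_cutEdges.1 he'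
    rw [Finset.mem_singleton] at ha ha'
    have h1 := hvA u hu
    have h2 := hvB u hu
    have h3 := hvA v hv
    have h4 := hvB v hv
    rw [Finset.mem_union] at hb hb'
    rw [Sym2.eq_iff] at heq
    grind
  have hdcut : Disjoint (cutEdges G A B) (R.biUnion F) := by
    rw [Finset.disjoint_biUnion_right]
    intro v hv
    rw [Finset.disjoint_left]
    intro e he he'
    obtain ⟨a, ha, b, hb, _, rfl⟩ := mem_cutEdges.1 he
    obtain ⟨a', ha', b', hb', _, heq⟩ := mem_cutEdges.1 he'
    rw [Finset.mem_singleton] at ha'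
    have h3 := hvA v hv
    have h4 := hvB v hv
    rw [Sym2.eq_iff] at heq
    grind
  set N : V → Finset (Sym2 V) → Prop := fun v ω =>
    ¬ (1 ≤ (ω ∩ cutEdges G {v} A).card ∧ k ≤ (ω ∩ cutEdges G {v} B).card) ∧
    ¬ (1 ≤ (ω ∩ cutEdges G {v} B).card ∧ k ≤ (ω ∩ cutEdges G {v} A).card) with hN
  have hNF : ∀ v ω, N v ω ↔ N v (ω ∩ F v) := by
    intro v ω
    simp only [hN, Finset.inter_assoc, Finset.inter_eq_right.2 (hFA v),
      Finset.inter_eq_right.2 (hFB v)]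
  have hprob : ∀ v ∈ R, bernProb (F v) p (N v) ≤
      Real.exp (-(min (A.filter (G.Adj v)).card (B.filter (G.Adj v)).card : ℕ) / (4 * d)) := by
    intro v hv
    have hdv := hdeg v hv
    have cA := card_cutEdges_singleton G (hvA v hv)
    have cB := card_cutEdges_singleton G (hvB v hv)
    have leA : (A.filter (G.Adj v)).card ≤ d := by
      rw [← card_neighbors hG v]
      exact Finset.card_le_card (Finset.filter_subset_filter _ (Finset.subset_univ _))
    have leB : (B.filter (G.Adj v)).card ≤ d := by
      rw [← card_neighbors hG v]
      exact Finset.card_le_card (Finset.filter_subset_filter _ (Finset.subset_univ _))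
    have fin : ∀ (m : ℕ) (Q : Finset (Sym2 V) → Prop),
        (m : ℝ) / (4 * d) ≤ bernProb (F v) p Q → (∀ ω, N v ω → ¬ Q ω) →
        bernProb (F v) p (N v) ≤ Real.exp (-(m : ℝ) / (4 * d)) := by
      intro m Q hm hQ
      refine (bernProb_mono hp0 hp1 fun ω _ h => hQ ω h).trans ?_
      rw [bernProb_not]
      have := Real.add_one_le_exp (-(m : ℝ) / (4 * d))
      rw [neg_div] at this ⊢
      linarith
    have hdis := disjoint_cutEdges_singleton G (hvA v hv) hAB
    -- At most k neighbours are lost, so the larger side has at least (d - k)/2 ≥ d/3 of them; it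
    -- must receive the k edges, the smaller side only one.
    rcases le_total (A.filter (G.Adj v)).card (B.filter (G.Adj v)).card with hle | hle
    · rw [min_eq_left hle, ← cA]
      exact fin _ _ (le_bernProb_cross (hFA v) (hFB v) hdis hd (by omega) (by omega))
        fun ω h => h.1
    · rw [min_eq_right hle, ← cB]
      exact fin _ _ (le_bernProb_cross (hFB v) (hFA v) hdis.symm hd (by omega) (by omega))
        fun ω h => h.2
  have hcut : bernProb (cutEdges G A B) p (fun ω => ω = ∅) ≤
      Real.exp (-((G.interedges A B).card : ℝ) / (4 * d)) := by
    rw [bernProb_eq_empty, card_cutEdges hAB]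
    calc (1 - p) ^ (G.interedges A B).card
        ≤ (Real.exp (-(1 / (4 * d)))) ^ (G.interedges A B).card := by
          refine pow_le_pow_left₀ (by linarith) ?_ _
          have h3 := Real.add_one_le_exp (-(1 / (4 * d) : ℝ))
          have h4 : 1 / (4 * d : ℝ) ≤ p := by
            have hk0 : (0 : ℝ) ≤ k := Nat.cast_nonneg k
            rw [hp, div_le_div_iff₀ (by positivity) hd0]
            nlinarith
          linarith
      _ = _ := by
          rw [← Real.exp_nat_mul]
          congr 1
          ring
  calc bernProb (edges G) p (IsSeparated G k A B R)
      = bernProb (edges G) p (fun ω => (ω ∩ cutEdges G A B = ∅) ∧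
          ∀ v ∈ R, N v (ω ∩ R.biUnion F)) := by
        have hsub : ∀ v ∈ R, ∀ ω : Finset (Sym2 V), ω ∩ F v = (ω ∩ R.biUnion F) ∩ F v := by
          intro v hv ω
          rw [Finset.inter_assoc, Finset.inter_eq_right.2 (Finset.subset_biUnion_of_mem F hv)]
        congr 1
        ext ω
        rw [IsSeparated]
        refine and_congr_right fun _ => forall₂_congr fun v hv => ?_
        change N v ω ↔ N v (ω ∩ R.biUnion F)
        rw [hNF, hsub v hv, ← hNF]
    _ = bernProb (cutEdges G A B) p (fun ω => ω = ∅) *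
          bernProb (R.biUnion F) p (fun ω => ∀ v ∈ R, N v ω) :=
        bernProb_mul_inter (cutEdges_subset _ _ _) (Finset.biUnion_subset.2 fun v _ => hFE v)
          hdcut p (fun ω => ω = ∅) (fun ω => ∀ v ∈ R, N v ω)
    _ = bernProb (cutEdges G A B) p (fun ω => ω = ∅) * ∏ v ∈ R, bernProb (F v) p (N v) := by
        congr 1
        simp only [bernProb]
        rw [← bernExp_prod_inter R F (fun v hv => Finset.subset_biUnion_of_mem F hv) hdF]
        refine bernExp_congr fun ω _ => ?_
        simp only [← hNF]
        rw [Finset.prod_boole]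
        congr
    _ ≤ Real.exp (-((G.interedges A B).card : ℝ) / (4 * d)) * ∏ v ∈ R,
          Real.exp (-(min (A.filter (G.Adj v)).card (B.filter (G.Adj v)).card : ℕ) / (4 * d)) := by
        gcongr with v hv
        · exact Finset.prod_nonneg fun v _ => bernProb_nonneg hp0 hp1 _
        · exact fun v _ => bernProb_nonneg hp0 hp1 _
        · exact hprob v hv
    _ = Real.exp (-(majorityCut G A B R / (4 * d))) := by
        rw [← Real.exp_sum, ← Real.exp_add, ← Finset.sum_div, Finset.sum_neg_distrib, ← add_div,
          majorityCut, ← neg_div]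
        congr 2
        push_cast
        ring

end SecondRound

/-! ### Combining the rounds; the deterministic criterion -/

section Combination

open scoped Classical

variable {V : Type*} [Fintype V] {G : SimpleGraph V} {d k : ℕ}

/-- All d > k neighbours of a low vertex are high; if there is no low vertex, any vertex serves
instead. -/
lemma lt_card_compl_lowVerts [Nonempty V] (hG : IsRegular G d) (hkd : k < d)
    {ω : Finset (Sym2 V)} (hlow : ∀ u ∈ lowVerts ω k, ∀ v ∈ lowVerts ω k, ¬ G.Adj u v) :
    k < (lowVerts ω k)ᶜ.card := by
  obtain ⟨v⟩ := ‹Nonempty V›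
  obtain ⟨w, hw⟩ : ∃ w, ∀ u, G.Adj w u → u ∈ (lowVerts ω k)ᶜ := by
    by_cases h : ∃ w, w ∈ lowVerts ω k
    · obtain ⟨w, hw⟩ := h
      exact ⟨w, fun u hu => Finset.mem_compl.2 fun hu' => hlow w hw u hu' hu⟩
    · exact ⟨v, fun u _ => Finset.mem_compl.2 fun hu' => h ⟨u, hu'⟩⟩
  refine hkd.trans_le ?_
  rw [← card_neighbors hG w]
  exact Finset.card_le_card fun u hu => hw u (Finset.mem_filter.1 hu).2

lemma coreVerts_nonempty [Nonempty V] (hG : IsRegular G d) (hkd : k < d)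
    {ω : Finset (Sym2 V)} (hlow : ∀ u ∈ lowVerts ω k, ∀ v ∈ lowVerts ω k, ¬ G.Adj u v)
    {X : Finset V} (hX : X.card < k) : (coreVerts ω k X).Nonempty := by
  have h1 := lt_card_compl_lowVerts hG hkd hlow
  obtain ⟨v, hv, hvX⟩ : ∃ v ∈ (lowVerts ω k)ᶜ, v ∉ X := by
    by_contra hcon
    push Not at hcon
    have := Finset.card_le_card (show (lowVerts ω k)ᶜ ⊆ X from hcon)
    omega
  refine ⟨v, mem_coreVerts.2 ⟨?_, hvX⟩⟩
  simpa using hv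

lemma nbrs_mono {ω ω' : Finset (Sym2 V)} (h : ω ⊆ ω') (v : V) : nbrs ω v ⊆ nbrs ω' v := by
  intro w hw
  rw [mem_nbrs] at hw ⊢
  exact h hw

lemma lowVerts_anti {ω ω' : Finset (Sym2 V)} (h : ω ⊆ ω') : lowVerts ω' k ⊆ lowVerts ω k := by
  intro v hv
  rw [mem_lowVerts] at hv ⊢
  exact (Finset.card_le_card (nbrs_mono h v)).trans_lt hv

lemma coreVerts_mono {ω ω' : Finset (Sym2 V)} (h : ω ⊆ ω') (X : Finset V) :
    coreVerts ω k X ⊆ coreVerts ω' k X :=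
  Finset.compl_subset_compl.2 (Finset.union_subset_union_left (lowVerts_anti h))

/-- The event of the union bound in the second round is unlikely for a fixed family of
components. -/
lemma bernProb_isSeparated_comps_le (hG : IsRegular G d) (hd : 6 * (k + 1) ≤ d) (hk : 1 ≤ k)
    {c : ℝ} (hc : 0 < c) (hglob : GlobalExpansion G c) {M : ℝ} {ω : Finset (Sym2 V)}
    (h : IsGoodRound G k M ω) {X : Finset V} (hX : X.card < k)
    (hM : 2 * (k : ℝ) ^ 2 * d ≤ min c 1 * M) {x : ℝ}
    (hx : Real.exp (-(min c 1 * M / (16 * k * d))) ≤ x)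
    {J : Finset (Finset V)} (hJ : J ⊆ coreComps ω k X) (hJ0 : J ≠ ∅) (hJ1 : J ≠ coreComps ω k X) :
    bernProb (edges G) (6 * (k + 1) / d) (IsSeparated G k (J.biUnion id)
      ((coreComps ω k X \ J).biUnion id) (restVerts ω k X))
      ≤ x ^ J.card + x ^ ((coreComps ω k X).card - J.card) := by
  set J' := coreComps ω k X \ J with hJ'
  have hJ's : J' ⊆ coreComps ω k X := Finset.sdiff_subset
  set A := J.biUnion id with hA
  set B := J'.biUnion id with hB
  set R := restVerts ω k X with hR
  have hAW : A ⊆ coreVerts ω k X := Finset.biUnion_subset.2 fun C hC =>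
    subset_coreVerts_of_mem (hJ hC)
  have hBW : B ⊆ coreVerts ω k X := Finset.biUnion_subset.2 fun C hC =>
    subset_coreVerts_of_mem (hJ's hC)
  have hWR : Disjoint (coreVerts ω k X) R := by
    rw [Finset.disjoint_left]
    intro v hv hv'
    have h1 := mem_coreVerts.1 hv
    have h2 := mem_restVerts.1 hv'
    omega
  have hAR : Disjoint A R := hWR.mono_left hAW
  have hBR : Disjoint B R := hWR.mono_left hBW
  have hWAB : ∀ v ∈ coreVerts ω k X, v ∈ A ∨ v ∈ B := by
    intro v hv
    have hC : coreComp ω k X v ∈ coreComps ω k X := mem_coreComps.2 ⟨v, hv, rfl⟩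
    by_cases hCJ : coreComp ω k X v ∈ J
    · exact Or.inl (Finset.mem_biUnion.2 ⟨_, hCJ, mem_coreComp_self v⟩)
    · exact Or.inr (Finset.mem_biUnion.2 ⟨_, Finset.mem_sdiff.2 ⟨hC, hCJ⟩, mem_coreComp_self v⟩)
  have hAB : Disjoint A B := by
    rw [Finset.disjoint_left]
    intro v hv hv'
    obtain ⟨C, hC, hvC⟩ := Finset.mem_biUnion.1 hv
    obtain ⟨C', hC', hvC'⟩ := Finset.mem_biUnion.1 hv'
    have e1 := eq_coreComp_of_mem (hJ hC) hvC
    have e2 := eq_coreComp_of_mem (hJ's hC') hvC'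
    rw [e1] at hC
    rw [e2] at hC'
    exact (Finset.mem_sdiff.1 hC').2 hC
  have hcov : A ∪ B ∪ R ∪ X = Finset.univ := by
    rw [Finset.eq_univ_iff_forall]
    intro v
    simp only [Finset.mem_union]
    by_cases hvX : v ∈ X
    · exact Or.inr hvX
    · left
      by_cases hvL : (nbrs ω v).card < k
      · exact Or.inr (mem_restVerts.2 ⟨hvL, hvX⟩)
      · exact Or.inl (hWAB v (mem_coreVerts.2 ⟨not_lt.1 hvL, hvX⟩))
  have hRL : ∀ v ∈ R, v ∈ lowVerts ω k := fun v hv => mem_lowVerts.2 (mem_restVerts.1 hv).1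
  have hdeg : ∀ v ∈ R, d ≤ (A.filter (G.Adj v)).card + (B.filter (G.Adj v)).card + k := by
    intro v hv
    rw [← card_neighbors hG v]
    have : Finset.univ.filter (G.Adj v) ⊆ A.filter (G.Adj v) ∪ B.filter (G.Adj v) ∪ X := by
      intro w hw
      rw [Finset.mem_filter] at hw
      by_cases hwX : w ∈ X
      · exact Finset.mem_union_right _ hwX
      have hwW : w ∈ coreVerts ω k X := by
        refine mem_coreVerts.2 ⟨?_, hwX⟩
        by_contra hlt
        exact h.not_adj_low v (hRL v hv) w (mem_lowVerts.2 (not_le.1 hlt)) hw.2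
      simp only [Finset.mem_union, Finset.mem_filter, hw.2, and_true]
      exact Or.inl (hWAB w hwW)
    refine (Finset.card_le_card this).trans ((Finset.card_union_le _ _).trans ?_)
    exact Nat.add_le_add (Finset.card_union_le _ _) hX.le
  have hatt : ∀ Y : Finset V, ∀ v ∈ attach ω k X Y, v ∈ Y ∨ v ∈ R ∧ ∃ u ∈ Y, G.Adj v u := by
    intro Y v hv
    rcases Finset.mem_union.1 hv with hv | hv
    · exact Or.inl hv
    · obtain ⟨hvR, u, hu, huv⟩ := Finset.mem_filter.1 hv
      refine Or.inr ⟨hvR, u, hu, ?_⟩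
      simpa using h.subset (mem_nbrs.1 huv)
  have hd0 : (0 : ℝ) < d := by
    have : 0 < d := by omega
    exact_mod_cast this
  have hk0 : (0 : ℝ) < k := by exact_mod_cast hk
  have hc1 : 0 < min c 1 := lt_min hc one_pos
  have hM0 : 0 ≤ M := by
    have : 0 ≤ min c 1 * M := le_trans (by positivity) hM
    exact nonneg_of_mul_nonneg_right this hc1
  have hcardJ' : J'.card = (coreComps ω k X).card - J.card := Finset.card_sdiff_of_subset hJ
  have hJ'pos : 1 ≤ J'.card := by
    refine Finset.card_pos.2 (Finset.sdiff_nonempty.2 fun hs => hJ1 (Finset.Subset.antisymm hJ hs))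
  have hJpos : 1 ≤ J.card := Finset.card_pos.2 (Finset.nonempty_iff_ne_empty.2 hJ0)
  -- Both sides contain at least m components, hence at least mM/k vertices after attachment. The
  -- two powers in the conclusion bound x^m whichever side attains the minimum.
  obtain ⟨m, hm⟩ : ∃ m, m = min J.card J'.card := ⟨_, rfl⟩
  have hm1 : 1 ≤ m := by omega
  have hmR : (1 : ℝ) ≤ m := by exact_mod_cast hm1
  have htA : m * M / k ≤ (attach ω k X A).card := by
    rw [div_le_iff₀' hk0]
    refine le_trans ?_ (card_mul_le_card_attach h hX hJ)
    gcongr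
    omega
  have htB : m * M / k ≤ (attach ω k X B).card := by
    rw [div_le_iff₀' hk0]
    refine le_trans ?_ (card_mul_le_card_attach h hX hJ's)
    gcongr
    omega
  have hD := le_majorityCut hG hc hglob
    (fun u hu v hv => h.not_adj_low u (hRL u hu) v (hRL v hv)) hcov hAB hAR hBR hX.le
    (hatt A) (hatt B) htA htB
  have hx0 : 0 < x := (Real.exp_pos _).trans_le hx
  refine (bernProb_isSeparated_le hG hd hAB hAR hBR hdeg).trans ?_
  have hexp : Real.exp (-(majorityCut G A B R / (4 * d))) ≤ x ^ m := by
    calc Real.exp (-(majorityCut G A B R / (4 * d)))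
        ≤ Real.exp (-(min c 1 * M / (16 * k * d))) ^ m := by
          rw [← Real.exp_nat_mul, Real.exp_le_exp, mul_neg, neg_le_neg_iff, mul_div_assoc',
            div_le_div_iff₀ (by positivity) (by positivity)]
          have e1 : min c 1 * (m * M / k) * k = m * (min c 1 * M) := by field_simp
          have h3 : m * (min c 1 * M) ≤ (2 * majorityCut G A B R + k * d) * k := by
            rw [← e1]
            gcongr
          -- The bound on M makes the loss k²d caused by X at most half of the main term; this gives
          -- 4Dk and, with the exponent D/(4d), the constant 16.
          have h4 : 2 * (k : ℝ) ^ 2 * d ≤ m * (min c 1 * M) :=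
            hM.trans (le_mul_of_one_le_left (le_trans (by positivity) hM) hmR)
          have h5 : m * (min c 1 * M) ≤ 4 * (majorityCut G A B R * k) := by nlinarith
          nlinarith
      _ ≤ x ^ m := by gcongr
  refine hexp.trans ?_
  rw [← hcardJ']
  rcases min_choice J.card J'.card with hmin | hmin
  · rw [hm, hmin]
    have : 0 ≤ x ^ J'.card := by positivity
    linarith
  · rw [hm, hmin]
    have : 0 ≤ x ^ J.card := by positivity
    linarith

/-- By the binomial theorem each sum over all subsets is (1 + x)^|s|. Excluding ∅ from the first and
s from the second removes a term 1 from each, which leaves a quantity that is small when |s| x is.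
-/
lemma sum_proper_subsets_le {α : Type*} [DecidableEq α] (s : Finset α) {x : ℝ} (hx : 0 ≤ x) :
    ∑ t ∈ s.powerset.filter (fun t => t ≠ ∅ ∧ t ≠ s), (x ^ t.card + x ^ (s.card - t.card))
      ≤ 2 * ((1 + x) ^ s.card - 1) := by
  have h1 : ∑ t ∈ s.powerset, x ^ t.card = (1 + x) ^ s.card := by
    rw [add_comm, ← Finset.sum_pow_mul_eq_add_pow]
    simp
  have h2 : ∑ t ∈ s.powerset, x ^ (s.card - t.card) = (1 + x) ^ s.card := by
    rw [← Finset.sum_pow_mul_eq_add_pow]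
    simp
  have h3 : ∑ t ∈ s.powerset.filter (fun t => t ≠ ∅ ∧ t ≠ s), x ^ t.card + 1
      ≤ ∑ t ∈ s.powerset, x ^ t.card := by
    have hn : ∅ ∉ s.powerset.filter (fun t => t ≠ ∅ ∧ t ≠ s) := by simp
    have := Finset.sum_insert (f := fun t : Finset α => x ^ t.card) hn
    rw [Finset.card_empty, pow_zero] at this
    rw [add_comm, ← this]
    refine Finset.sum_le_sum_of_subset_of_nonneg ?_ fun t _ _ => by positivity
    intro t ht
    rw [Finset.mem_insert, Finset.mem_filter] at ht
    rcases ht with rfl | ht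
    · simp
    · exact ht.1
  have h4 : ∑ t ∈ s.powerset.filter (fun t => t ≠ ∅ ∧ t ≠ s), x ^ (s.card - t.card) + 1
      ≤ ∑ t ∈ s.powerset, x ^ (s.card - t.card) := by
    have hn : s ∉ s.powerset.filter (fun t => t ≠ ∅ ∧ t ≠ s) := by simp
    have := Finset.sum_insert (f := fun t : Finset α => x ^ (s.card - t.card)) hn
    rw [Nat.sub_self, pow_zero] at this
    rw [add_comm, ← this]
    refine Finset.sum_le_sum_of_subset_of_nonneg ?_ fun t _ _ => by positivity
    intro t ht
    rw [Finset.mem_insert, Finset.mem_filter] at ht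
    rcases ht with rfl | ht
    · simp
    · exact ht.1
  rw [Finset.sum_add_distrib]
  linarith

/-- After a good first round, deleting `X` rarely disconnects the vertices of degree at
least `k`. -/
lemma bernProb_not_connected_le [Nonempty V] (hG : IsRegular G d) (hd : 6 * (k + 1) ≤ d)
    (hk : 1 ≤ k) {c : ℝ} (hc : 0 < c) (hglob : GlobalExpansion G c) {M : ℝ} {ω : Finset (Sym2 V)}
    (h : IsGoodRound G k M ω) {X : Finset V} (hX : X.card < k)
    (hM : 2 * (k : ℝ) ^ 2 * d ≤ min c 1 * M) {x : ℝ}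
    (hx : Real.exp (-(min c 1 * M / (16 * k * d))) ≤ x) :
    bernProb (edges G) (6 * (k + 1) / d) (fun ω₂ =>
      ¬ ((graphOf (ω ∪ ω₂)).induce {v | v ∈ coreVerts (ω ∪ ω₂) k X}).Connected)
      ≤ 2 * ((1 + x) ^ Fintype.card V - 1) := by
  have hd0 : (0 : ℝ) < d := by
    have : 0 < d := by omega
    exact_mod_cast this
  have hp0 : (0 : ℝ) ≤ 6 * (k + 1) / d := by positivity
  have hp1 : (6 * (k + 1) / d : ℝ) ≤ 1 := (div_le_one hd0).2 (by exact_mod_cast hd)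
  have hx0 : 0 < x := (Real.exp_pos _).trans_le hx
  calc bernProb (edges G) (6 * (k + 1) / d) (fun ω₂ =>
      ¬ ((graphOf (ω ∪ ω₂)).induce {v | v ∈ coreVerts (ω ∪ ω₂) k X}).Connected)
      ≤ bernProb (edges G) (6 * (k + 1) / d) (fun ω₂ =>
          ∃ J ∈ (coreComps ω k X).powerset.filter (fun J => J ≠ ∅ ∧ J ≠ coreComps ω k X),
            IsSeparated G k (J.biUnion id) ((coreComps ω k X \ J).biUnion id)
              (restVerts ω k X) ω₂) := by
        refine bernProb_mono hp0 hp1 fun ω₂ hω₂ hdis => ?_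
        have hne : {v | v ∈ coreVerts (ω ∪ ω₂) k X}.Nonempty :=
          (coreVerts_nonempty hG (by omega) h.not_adj_low hX).mono
            (coreVerts_mono Finset.subset_union_left X)
        obtain ⟨J, hJ, hJ', hsep⟩ := exists_isSeparated hk h hω₂ hX rfl hne hdis
        exact ⟨J, Finset.mem_filter.2 ⟨hJ, hJ'⟩, hsep⟩
    _ ≤ ∑ J ∈ (coreComps ω k X).powerset.filter (fun J => J ≠ ∅ ∧ J ≠ coreComps ω k X),
          (x ^ J.card + x ^ ((coreComps ω k X).card - J.card)) := by
        refine (bernProb_exists_le hp0 hp1 _ _).trans (Finset.sum_le_sum fun J hJ => ?_)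
        rw [Finset.mem_filter, Finset.mem_powerset] at hJ
        exact bernProb_isSeparated_comps_le hG hd hk hc hglob h hX hM hx hJ.1 hJ.2.1 hJ.2.2
    _ ≤ 2 * ((1 + x) ^ (coreComps ω k X).card - 1) := sum_proper_subsets_le _ hx0.le
    _ ≤ 2 * ((1 + x) ^ Fintype.card V - 1) := by
        gcongr
        · linarith
        · exact card_coreComps_le

lemma ncard_neighborSet_graphOf {ω : Finset (Sym2 V)} (hω : ω ⊆ edges G) (v : V) :
    ((graphOf ω).neighborSet v).ncard = (nbrs ω v).card := by
  rw [← Set.ncard_coe_finset]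
  congr 1
  ext w
  simp only [SimpleGraph.mem_neighborSet, Finset.mem_coe, mem_nbrs]
  exact ⟨fun h => by simpa using h.1, graphOf_adj_of_mem hω⟩

/-- Deleting the fewer than k neighbours of v would isolate v, while T, having more than k vertices,
still contains another one. -/
lemma le_ncard_neighborSet_of_isKConnectedOn {H : SimpleGraph V} {T : Set V}
    (hT : IsKConnectedOn H k T) {v : V} (hv : v ∈ T) : k ≤ (H.neighborSet v).ncard := by
  by_contra hlt
  have hcon := hT.2 (H.neighborSet v) (not_le.1 hlt)
  have hvT : v ∈ T \ H.neighborSet v := ⟨hv, by simp⟩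
  obtain ⟨w, hw, hwX⟩ : ∃ w ∈ T, w ∉ insert v (H.neighborSet v) := by
    by_contra hcon'
    push Not at hcon'
    have h1 := Set.ncard_le_ncard (show T ⊆ insert v (H.neighborSet v) from hcon')
    have h2 := Set.ncard_insert_le v (H.neighborSet v)
    have h3 := hT.1
    omega
  rw [Set.mem_insert_iff, not_or] at hwX
  have hr := hcon.preconnected ⟨v, hvT⟩ ⟨w, hw, hwX.2⟩
  have := mem_of_reachable (K := H.induce (T \ H.neighborSet v)) (U := {⟨v, hvT⟩}) ?_ rfl hr
  · exact hwX.1 (congrArg Subtype.val this)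
  · rintro a rfl b hab
    exact absurd hab b.2.2

/-- Deterministic criterion for the unique `k`-connected component. -/
lemma hasUniqueKConnectedComponent_of_connected [Nonempty V] (hG : IsRegular G d) (hk : 1 ≤ k)
    (hkd : k < d) {ω : Finset (Sym2 V)} (hω : ω ⊆ edges G)
    (hlow : ∀ u ∈ lowVerts ω k, ∀ v ∈ lowVerts ω k, ¬ G.Adj u v)
    (hconn : ∀ X : Finset V, X.card < k →
      ((graphOf ω).induce {v | v ∈ coreVerts ω k X}).Connected) :
    HasUniqueKConnectedComponent G k (graphOf ω) := by
  set S : Set V := (((lowVerts ω k)ᶜ : Finset V) : Set V) with hS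
  have hmem : ∀ v, v ∈ S ↔ k ≤ (nbrs ω v).card := by
    intro v
    simp [hS]
  have hSk : IsKConnectedOn (graphOf ω) k S := by
    refine ⟨?_, fun X hX => ?_⟩
    · rw [hS, Set.ncard_coe_finset]
      exact lt_card_compl_lowVerts hG hkd hlow
    · have h1 := hconn X.toFinset (by rwa [← Set.ncard_eq_toFinset_card'])
      have e : S \ X = {v | v ∈ coreVerts ω k X.toFinset} := by
        ext v
        rw [Set.mem_sdiff, hmem]
        simp [mem_coreVerts]
      rw [e]
      exact h1
  -- S is the greatest k-connected set, not merely a maximal one, which gives uniqueness.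
  have hmax : ∀ T, IsKConnectedOn (graphOf ω) k T → T ⊆ S := by
    intro T hT v hv
    rw [hmem, ← ncard_neighborSet_graphOf hω]
    exact le_ncard_neighborSet_of_isKConnectedOn hT hv
  refine ⟨S, ⟨hSk, fun T hT _ => hmax T hT⟩, fun T hT => ?_, fun v hv => ?_, fun u v hu hv huv => ?_⟩
  · exact Set.Subset.antisymm (hmax T hT.1) (hT.2 hSk (hmax T hT.1))
  · rw [ncard_neighborSet_graphOf hω]
    rw [hmem] at hv
    omega
  · have hnadj : ¬ G.Adj u v := by
      refine hlow u ?_ v ?_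
      · rw [mem_lowVerts]
        rw [hmem] at hu
        omega
      · rw [mem_lowVerts]
        rw [hmem] at hv
        omega
    by_contra hlt
    have h1 : G.edist u v ≤ 1 := by
      rw [not_le, show (2 : ℕ∞) = 1 + 1 from rfl] at hlt
      exact ENat.lt_add_one_iff (by simp) |>.1 hlt
    rcases SimpleGraph.edist_le_one_iff_adj_or_eq.1 h1 with h0 | h0
    · exact hnadj h0
    · exact huv h0

lemma card_filter_card_lt_le [Nonempty V] (k : ℕ) :
    (Finset.univ.filter fun X : Finset V => X.card < k).card ≤ k * Fintype.card V ^ k := by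
  have hsub : (Finset.univ.filter fun X : Finset V => X.card < k) ⊆
      (Finset.range k).biUnion fun i => Finset.powersetCard i Finset.univ := by
    intro X hX
    rw [Finset.mem_biUnion]
    exact ⟨X.card, Finset.mem_range.2 (Finset.mem_filter.1 hX).2,
      Finset.mem_powersetCard.2 ⟨Finset.subset_univ _, rfl⟩⟩
  refine (Finset.card_le_card hsub).trans (Finset.card_biUnion_le.trans ?_)
  have := Finset.sum_le_card_nsmul (Finset.range k)
    (fun i => (Finset.powersetCard i (Finset.univ : Finset V)).card) (Fintype.card V ^ k) ?_
  · simpa using this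
  · intro i hi
    rw [Finset.card_powersetCard, Finset.card_univ]
    exact (Nat.choose_le_pow _ _).trans
      (Nat.pow_le_pow_right Fintype.card_pos (Finset.mem_range.1 hi).le)

/-- Bound for the failure probability in terms of the two rounds. -/
lemma bernProb_not_hasUnique_le [Nonempty V] (hG : IsRegular G d) (hd : 6 * (k + 1) ≤ d)
    (hk : 1 ≤ k) {c : ℝ} (hc : 0 < c) (hglob : GlobalExpansion G c) {C ε : ℝ}
    (hloc : LocalExpansion G d C ε) (hε : ε ≤ 1 / 4) {p q Λ y x : ℝ} (hp0 : 0 ≤ p) (hq0 : 0 < q)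
    (hpq : 1 - p = q) (hΛ1 : 1 ≤ Λ) (hΛ : d * p ≤ Λ * q)
    (hy : 4 * Real.exp 1 * Λ ^ (k + 1) * (q ^ d) ^ (3 / 4 : ℝ) ≤ y) (hy1 : y ≤ 1 / 2)
    (hM : 2 * (k : ℝ) ^ 2 * d ≤ min c 1 * (C * d * Real.log (Fintype.card V)))
    (hx : Real.exp (-(min c 1 * (C * d * Real.log (Fintype.card V)) / (16 * k * d))) ≤ x) :
    bernProb (edges G) (1 - q * (1 - 6 * (k + 1) / d))
      (fun ω => ¬ HasUniqueKConnectedComponent G k (graphOf ω))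
      ≤ 2 * Fintype.card V * y ^ 2
        + Fintype.card V * d * (Λ ^ (2 * k) * (Real.exp 1 * q ^ d) ^ 2 / q ^ 2)
        + k * (Fintype.card V : ℝ) ^ k * (2 * ((1 + x) ^ Fintype.card V - 1)) := by
  have hd0 : (0 : ℝ) < d := by
    have : 0 < d := by omega
    exact_mod_cast this
  have hd1 : 1 ≤ d := by omega
  have hp1 : p ≤ 1 := by linarith
  have hs0 : (0 : ℝ) ≤ 6 * (k + 1) / d := by positivity
  have hs1 : (6 * (k + 1) / d : ℝ) ≤ 1 := (div_le_one hd0).2 (by exact_mod_cast hd)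
  have hx0 : 0 < x := (Real.exp_pos _).trans_le hx
  set M : ℝ := C * d * Real.log (Fintype.card V) with hMdef
  set η : ℝ := k * (Fintype.card V : ℝ) ^ k * (2 * ((1 + x) ^ Fintype.card V - 1)) with hη
  have hη0 : 0 ≤ 2 * ((1 + x) ^ Fintype.card V - 1) := by
    have := one_le_pow₀ (n := Fintype.card V) (by linarith : (1 : ℝ) ≤ 1 + x)
    linarith
  have hgood : ∀ ω, IsGoodRound G k M ω → bernProb (edges G) (6 * (k + 1) / d)
      (fun ω₂ => ¬ HasUniqueKConnectedComponent G k (graphOf (ω ∪ ω₂))) ≤ η := by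
    intro ω hω
    calc bernProb (edges G) (6 * (k + 1) / d)
          (fun ω₂ => ¬ HasUniqueKConnectedComponent G k (graphOf (ω ∪ ω₂)))
        ≤ bernProb (edges G) (6 * (k + 1) / d) (fun ω₂ =>
            ∃ X ∈ Finset.univ.filter fun X : Finset V => X.card < k,
              ¬ ((graphOf (ω ∪ ω₂)).induce {v | v ∈ coreVerts (ω ∪ ω₂) k X}).Connected) := by
          refine bernProb_mono hs0 hs1 fun ω₂ hω₂ hnot => ?_
          by_contra hcon
          push Not at hcon
          refine hnot (hasUniqueKConnectedComponent_of_connected hG hk (by omega)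
            (Finset.union_subset hω.subset hω₂) ?_ fun X hX => hcon X (by simpa using hX))
          intro u hu v hv
          have hsub := lowVerts_anti (k := k) (Finset.subset_union_left (s₁ := ω) (s₂ := ω₂))
          exact hω.not_adj_low u (hsub hu) v (hsub hv)
      _ ≤ ∑ X ∈ Finset.univ.filter fun X : Finset V => X.card < k,
            2 * ((1 + x) ^ Fintype.card V - 1) := by
          refine (bernProb_exists_le hs0 hs1 _ _).trans (Finset.sum_le_sum fun X hX => ?_)
          exact bernProb_not_connected_le hG hd hk hc hglob hω (by simpa using hX) hM hx
      _ ≤ η := by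
          rw [Finset.sum_const, nsmul_eq_mul, hη]
          refine mul_le_mul_of_nonneg_right ?_ hη0
          exact_mod_cast card_filter_card_lt_le k
  set N₁ : Finset (Sym2 V) → Prop := fun ω => ∃ U : Finset V, 2 ≤ U.card ∧
      (U.card : ℝ) ≤ M ∧ IsNearlyIsolated G k ω U with hN₁
  set N₂ : Finset (Sym2 V) → Prop := fun ω => ∃ u v : V, G.Adj u v ∧
      (ω ∩ cutEdges G {u, v} {u, v}ᶜ).card ≤ 2 * k with hN₂
  have e : 1 - q * (1 - 6 * (k + 1) / d) = 1 - (1 - p) * (1 - 6 * (k + 1) / d) := by rw [hpq]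
  calc bernProb (edges G) (1 - q * (1 - 6 * (k + 1) / d))
        (fun ω => ¬ HasUniqueKConnectedComponent G k (graphOf ω))
      = bernExp (edges G) p fun ω₁ => bernProb (edges G) (6 * (k + 1) / d)
          (fun ω₂ => ¬ HasUniqueKConnectedComponent G k (graphOf (ω₁ ∪ ω₂))) := by
        rw [bernProb, e, bernExp_sprinkle]
        rfl
    -- A bad first round is charged probability one; after a good one the conditional failure
    -- probability is at most η.
    _ ≤ bernExp (edges G) p fun ω₁ => (if N₁ ω₁ ∨ N₂ ω₁ then 1 else 0) + η := by
        refine bernExp_mono hp0 hp1 fun ω hω => ?_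
        split_ifs with hN
        · have h1 := bernProb_le_one (E := edges G) hs0 hs1
            (fun ω₂ => ¬ HasUniqueKConnectedComponent G k (graphOf (ω ∪ ω₂)))
          have h2 : 0 ≤ η := by positivity
          linarith
        · rw [not_or] at hN
          rw [zero_add]
          exact hgood ω (isGoodRound_of_not_exists hω hN.1 hN.2)
    _ = bernProb (edges G) p (fun ω => N₁ ω ∨ N₂ ω) + η := by
        rw [bernExp_add, bernExp_const]
        congr 1
        exact bernExp_congr fun ω _ => by congr
    _ ≤ _ := by
        gcongr
        refine (bernProb_or_le hp0 hp1 _ _).trans (add_le_add ?_ ?_)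
        · exact bernProb_exists_isNearlyIsolated_le hG hd1 hloc hε hp0 hq0 hpq hΛ1 hΛ k hy hy1
        · exact bernProb_exists_adj_low_le hG hd1 hp0 hq0 hpq hΛ1 hΛ k

end Combination

/-! ### From the measure on graphs to finite sums -/

section Conversion

open scoped Classical

variable {V : Type*} [Fintype V]

/-- The law is carried by the finitely many subsets of the edge set, so the event is a finite
disjoint union of atoms of explicit mass. -/
lemma randomSubgraph_real (G : SimpleGraph V) (p : unitInterval) (P : SimpleGraph V → Prop) :
    (randomSubgraph G p).real {H | P H} = bernProb (edges G) p fun ω => P (graphOf ω) := by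
  have hmeas : Measurable (SimpleGraph.fromEdgeSet : Set (Sym2 V) → SimpleGraph V) := by fun_prop
  have hP : MeasurableSet {H : SimpleGraph V | P H} := by
    rw [← SimpleGraph.edgeSet_injective.preimage_image {H : SimpleGraph V | P H}]
    exact SimpleGraph.measurable_edgeSet .of_discrete
  have hE : ∀ ω : Finset (Sym2 V), ω ⊆ edges G → (ω : Set (Sym2 V)) ⊆ G.edgeSet :=
    fun ω hω e he => mem_edges.1 (hω he)
  have hEc : G.edgeSet = (edges G : Set (Sym2 V)) := by ext; simp
  rw [measureReal_def, randomSubgraph, Measure.map_apply hmeas hP,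
    setBernoulli_apply_eq_apply_subsets, ← measureReal_def]
  have hset : {s | s ∈ SimpleGraph.fromEdgeSet ⁻¹' {H | P H} ∧ s ⊆ G.edgeSet}
      = ⋃ ω ∈ (edges G).powerset.filter fun ω => P (graphOf ω), {(ω : Set (Sym2 V))} := by
    ext s
    simp only [Set.mem_iUnion, Finset.mem_filter, Finset.mem_powerset, Set.mem_singleton_iff,
      exists_prop]
    constructor
    · rintro ⟨h1, h2⟩
      refine ⟨s.toFinset, ⟨fun e he => mem_edges.2 (h2 (Set.mem_toFinset.1 he)), ?_⟩, by simp⟩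
      rw [Set.mem_preimage, Set.mem_ofPred_eq] at h1
      rwa [graphOf, Set.coe_toFinset]
    · rintro ⟨ω, ⟨h1, h2⟩, rfl⟩
      exact ⟨h2, hE ω h1⟩
  rw [hset, measureReal_biUnion_finset ?_ (fun _ _ => .of_discrete)]
  · rw [bernProb, bernExp, Finset.sum_filter]
    refine Finset.sum_congr rfl fun ω hω => ?_
    rw [Finset.mem_powerset] at hω
    split_ifs with h
    · rw [setBernoulli_real_singleton p (hE ω hω) (Set.toFinite _), mul_one, Set.ncard_coe_finset,
        hEc, ← Finset.coe_sdiff, Set.ncard_coe_finset]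
    · simp
  · intro ω _ ω' _ hne
    simpa [Function.onFun] using hne

lemma randomSubgraph_real_le_one (G : SimpleGraph V) (p : unitInterval)
    (P : SimpleGraph V → Prop) : (randomSubgraph G p).real {H | P H} ≤ 1 := by
  rw [randomSubgraph_real]
  exact bernProb_le_one p.2.1 p.2.2 _

lemma one_sub_le_randomSubgraph_real {G : SimpleGraph V} {p : unitInterval}
    {P : SimpleGraph V → Prop} {b : ℝ}
    (h : bernProb (edges G) p (fun ω => ¬ P (graphOf ω)) ≤ b) :
    1 - b ≤ (randomSubgraph G p).real {H | P H} := by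
  rw [randomSubgraph_real]
  rw [bernProb_not] at h
  linarith

end Conversion

/-! ### Choice of parameters and polynomial error bounds -/

section Asymptotics

lemma exp_neg_two_mul_le {t : ℝ} (h0 : 0 ≤ t) (h1 : t ≤ 1 / 2) : Real.exp (-(2 * t)) ≤ 1 - t := by
  rw [Real.exp_neg, inv_le_comm₀ (Real.exp_pos _) (by linarith)]
  have := Real.add_one_le_exp (2 * t)
  refine le_trans ?_ this
  rw [inv_le_iff_one_le_mul₀ (by linarith)]
  nlinarith

lemma one_add_pow_sub_one_le {x : ℝ} (hx : 0 ≤ x) {n : ℕ} (hn : n * x ≤ 1 / 2) :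
    (1 + x) ^ n - 1 ≤ 2 * (n * x) := by
  have h1 : (1 + x) ^ n ≤ Real.exp (n * x) := by
    rw [Real.exp_nat_mul]
    have := Real.add_one_le_exp x
    exact pow_le_pow_left₀ (by linarith) (by linarith) n
  have h0 : (0 : ℝ) ≤ n * x := by positivity
  have h2 : Real.exp (n * x) ≤ 1 + 2 * (n * x) := by
    have h3 := Real.add_one_le_exp (-(n * x))
    have h4 : Real.exp (n * x) ≤ (1 - n * x)⁻¹ := by
      rw [le_inv_comm₀ (Real.exp_pos _) (by linarith), ← Real.exp_neg]
      linarith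
    refine h4.trans ?_
    rw [inv_le_iff_one_le_mul₀ (by linarith)]
    nlinarith
  linarith

/-- With y = log N this bounds d(1/q - 1) by log N up to a subpolynomial factor, so that Λ = N^δ is
admissible. -/
lemma mul_exp_div_sub_one_le {d y : ℝ} (hd : 0 < d) :
    d * (Real.exp (y / d) - 1) ≤ y * Real.exp (y / d) := by
  have h1 := Real.add_one_le_exp (-(y / d))
  have h2 : Real.exp (y / d) * Real.exp (-(y / d)) = 1 := by rw [← Real.exp_add]; simp
  have h3 : Real.exp (y / d) - 1 ≤ y / d * Real.exp (y / d) := by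
    have := mul_le_mul_of_nonneg_left h1 (Real.exp_pos (y / d)).le
    nlinarith
  calc d * (Real.exp (y / d) - 1) ≤ d * (y / d * Real.exp (y / d)) := by gcongr
    _ = y * Real.exp (y / d) := by field_simp

open scoped Classical

variable {V : Type*} [Fintype V] [Nonempty V]

/-- The failure probability is polynomially small in the number of vertices. -/
lemma bernProb_not_hasUnique_le_rpow {G : SimpleGraph V} {d k : ℕ} (hG : IsRegular G d)
    (hk : 1 ≤ k) (hd : 12 * (k + 1) ≤ d) {c : ℝ} (hc : 0 < c) (hglob : GlobalExpansion G c)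
    {ε : ℝ} (hloc : LocalExpansion G d (16 * k * (k + 2) / min c 1) ε) (hε : ε ≤ 1 / 4)
    {N : ℝ} (hN : N = Fintype.card V) {a δ φ : ℝ} (hδ : 0 < δ) (hδ1 : δ * (12 * (k + 3)) ≤ 1)
    (hδ2 : δ * (2 * (2 * k + 5)) ≤ a) (hda : (d : ℝ) ≤ N ^ (1 - a)) (hdδ : 2 / δ ≤ d)
    (hφ1 : 1 ≤ φ) (hφ : φ * Real.exp (12 * (k + 1)) ≤ N ^ δ) (hlog1 : 1 ≤ Real.log N)
    (hlog : Real.log N ≤ N ^ (δ / 2)) (hconst : 4 * Real.exp 1 ≤ N ^ δ)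
    (hhalf : N ^ (-(2 / 3) : ℝ) ≤ 1 / 2) :
    bernProb (edges G) (1 - (φ / N) ^ (1 / (d : ℝ)))
      (fun ω => ¬ HasUniqueKConnectedComponent G k (graphOf ω))
      ≤ 2 * N ^ (-(1 / 3) : ℝ) + N ^ (-(a / 2)) + 4 * k * N⁻¹ := by
  have hk0 : (1 : ℝ) ≤ k := by exact_mod_cast hk
  have hN1 : 1 ≤ N := by
    rw [hN]
    exact_mod_cast Fintype.card_pos
  have hN0 : 0 < N := by linarith
  have hd0 : (0 : ℝ) < d := by
    have : 0 < d := by omega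
    exact_mod_cast this
  have hdne : d ≠ 0 := by omega
  have hdk : 12 * ((k : ℝ) + 1) ≤ d := by exact_mod_cast hd
  have hmono : ∀ {s t : ℝ}, s ≤ t → N ^ s ≤ N ^ t := fun h => Real.rpow_le_rpow_of_exponent_le hN1 h
  set r : ℝ := (φ / N) ^ (1 / (d : ℝ)) with hr
  set q₂ : ℝ := 1 - 6 * (k + 1) / d with hq₂
  have hφN : 0 < φ / N := by positivity
  have hr0 : 0 < r := by positivity
  have hrd : r ^ d = φ / N := by
    rw [hr, one_div]
    exact Real.rpow_inv_natCast_pow hφN.le hdne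
  have hθ : 6 * ((k : ℝ) + 1) / d ≤ 1 / 2 := by
    rw [div_le_div_iff₀ hd0 (by norm_num)]
    linarith
  have hθ0 : 0 ≤ 6 * ((k : ℝ) + 1) / d := by positivity
  have hq₂0 : 0 < q₂ := by linarith
  have hq₂1 : q₂ ≤ 1 := by linarith
  have hq₂d : Real.exp (-(12 * (k + 1))) ≤ q₂ ^ d := by
    calc Real.exp (-(12 * (k + 1))) = Real.exp (-(2 * (6 * (k + 1) / d))) ^ d := by
          rw [← Real.exp_nat_mul]
          congr 1
          field_simp
          ring
      _ ≤ q₂ ^ d := pow_le_pow_left₀ (Real.exp_pos _).le (exp_neg_two_mul_le hθ0 hθ) d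
  -- The removal probabilities of the rounds must multiply to r. As `q₂ ^ d` is bounded below by a
  -- constant, q^d exceeds φ/N only by a constant factor, absorbed in N^δ.
  set q : ℝ := r / q₂ with hq
  have hq0 : 0 < q := by positivity
  have hqd : q ^ d ≤ N ^ (-1 + δ) := by
    rw [hq, div_pow, hrd, Real.rpow_add hN0, Real.rpow_neg_one, div_div, div_le_iff₀ (by positivity)]
    calc φ = φ * Real.exp (12 * (k + 1)) * Real.exp (-(12 * (k + 1))) := by
          rw [mul_assoc, ← Real.exp_add]
          simp
      _ ≤ N ^ δ * q₂ ^ d := by gcongr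
      _ = N⁻¹ * N ^ δ * (N * q₂ ^ d) := by field_simp
  have hδsmall : δ ≤ 1 / 48 := by
    have := mul_le_mul_of_nonneg_left (show (48 : ℝ) ≤ 12 * (k + 3) by linarith) hδ.le
    linarith
  have hq1 : q ≤ 1 := by
    refine (pow_le_one_iff_of_nonneg hq0.le hdne).1 (hqd.trans ?_)
    exact Real.rpow_le_one_of_one_le_of_nonpos hN1 (by linarith)
  have hrq : r ≤ q := by
    rw [hq, le_div_iff₀ hq₂0]
    exact mul_le_of_le_one_right hr0.le hq₂1
  have hqinv : q⁻¹ ≤ Real.exp (Real.log N / d) := by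
    calc q⁻¹ ≤ r⁻¹ := by gcongr
      _ = (N / φ) ^ (1 / (d : ℝ)) := by
          rw [hr, ← Real.inv_rpow hφN.le, inv_div]
      _ ≤ N ^ (1 / (d : ℝ)) := by
          gcongr
          exact div_le_self hN0.le hφ1
      _ = Real.exp (Real.log N / d) := by
          rw [Real.rpow_def_of_pos hN0]
          congr 1
          ring
  have hexpd : Real.exp (Real.log N / d) ≤ N ^ (δ / 2) := by
    rw [Real.rpow_def_of_pos hN0, Real.exp_le_exp, div_le_iff₀ hd0]
    rw [div_le_iff₀ hδ] at hdδ
    have := mul_le_mul_of_nonneg_left hdδ (zero_le_one.trans hlog1)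
    linarith
  have hΛ : d * (1 - q) ≤ N ^ δ * q := by
    have h1 : d * (q⁻¹ - 1) ≤ N ^ δ := by
      calc d * (q⁻¹ - 1) ≤ d * (Real.exp (Real.log N / d) - 1) := by gcongr
        _ ≤ Real.log N * Real.exp (Real.log N / d) := mul_exp_div_sub_one_le hd0
        _ ≤ N ^ (δ / 2) * N ^ (δ / 2) := by gcongr
        _ = N ^ δ := by rw [← Real.rpow_add hN0]; ring_nf
    calc d * (1 - q) = d * (q⁻¹ - 1) * q := by field_simp
      _ ≤ N ^ δ * q := by gcongr
  have hΛ1 : 1 ≤ N ^ δ := Real.one_le_rpow hN1 hδ.le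
  have hm0 : 0 < min c 1 := lt_min hc one_pos
  have hlogN : Real.log (Fintype.card V) = Real.log N := by rw [hN]
  have hMN : min c 1 * (16 * k * (k + 2) / min c 1 * d * Real.log N)
      = 16 * k * (k + 2) * d * Real.log N := by field_simp
  -- One factor N comes from (1 + x)^N - 1 and N^k from the choices of X, so the exponent k + 2
  -- leaves N^(-1).
  set x : ℝ := N ^ (-((k : ℝ) + 2)) with hx
  have hmain := bernProb_not_hasUnique_le (x := x) (y := N ^ (-(2 / 3) : ℝ)) (Λ := N ^ δ) hG
    (by omega) hk hc hglob hloc hε (sub_nonneg.2 hq1) hq0 (sub_sub_cancel 1 q) hΛ1 hΛ ?_ hhalf ?_ ?_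
  · have e1 : 1 - q * (1 - 6 * (k + 1) / d) = 1 - r := by
      rw [← hq₂, hq, div_mul_cancel₀ _ hq₂0.ne']
    rw [e1, ← hN] at hmain
    refine hmain.trans (add_le_add (add_le_add ?_ ?_) ?_)
    · rw [← Real.rpow_natCast, ← Real.rpow_mul hN0.le, mul_assoc]
      gcongr
      rw [← Real.rpow_one_add' hN0.le (by norm_num)]
      exact hmono (by norm_num)
    · have h1 : Real.exp 1 * q ^ d ≤ N ^ (-1 + 2 * δ) := by
        calc Real.exp 1 * q ^ d ≤ N ^ δ * N ^ (-1 + δ) := by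
              have : Real.exp 1 ≤ N ^ δ := by
                have := Real.exp_pos 1
                linarith
              gcongr
          _ = N ^ (-1 + 2 * δ) := by rw [← Real.rpow_add hN0]; ring_nf
      calc N * d * ((N ^ δ) ^ (2 * k) * (Real.exp 1 * q ^ d) ^ 2 / q ^ 2)
          = N * d * ((N ^ δ) ^ (2 * k) * (Real.exp 1 * q ^ d) ^ 2 * (q⁻¹) ^ 2) := by
            rw [inv_pow, ← div_eq_mul_inv]
        _ ≤ N * N ^ (1 - a) * ((N ^ δ) ^ (2 * k) * (N ^ (-1 + 2 * δ)) ^ 2 * (N ^ (δ / 2)) ^ 2) := by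
            have := hqinv.trans hexpd
            gcongr
        _ = N ^ (-a + (2 * k + 5) * δ) := by
            rw [← Real.rpow_mul_natCast hN0.le, ← Real.rpow_mul_natCast hN0.le,
              ← Real.rpow_mul_natCast hN0.le, ← Real.rpow_add hN0, ← Real.rpow_add hN0]
            nth_rewrite 1 [← Real.rpow_one N]
            rw [← Real.rpow_add hN0, ← Real.rpow_add hN0]
            congr 1
            push_cast
            ring
        -- `hδ2` keeps the losses (2k+5)δ below half of the gain a from d ≤ N^(1-a).
        _ ≤ N ^ (-(a / 2)) := hmono (by linarith)
    · have hx0 : 0 ≤ x := by positivity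
      have hNx : N * x = N ^ (-((k : ℝ) + 1)) := by
        nth_rewrite 1 [← Real.rpow_one N]
        rw [hx, ← Real.rpow_add hN0]
        congr 1
        ring
      have hNx2 : (Fintype.card V : ℝ) * x ≤ 1 / 2 := by
        rw [← hN, hNx]
        exact (hmono (by linarith)).trans hhalf
      have h2 := one_add_pow_sub_one_le hx0 hNx2
      rw [← hN] at h2
      calc k * N ^ k * (2 * ((1 + x) ^ Fintype.card V - 1)) ≤ k * N ^ k * (2 * (2 * (N * x))) := by
            gcongr
        _ = 4 * k * (N ^ k * (N * x)) := by ring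
        _ = 4 * k * N⁻¹ := by
            rw [hNx, ← Real.rpow_natCast, ← Real.rpow_add hN0, ← Real.rpow_neg_one]
            congr 2
            ring
  · calc 4 * Real.exp 1 * (N ^ δ) ^ (k + 1) * (q ^ d) ^ (3 / 4 : ℝ)
        ≤ N ^ δ * (N ^ δ) ^ (k + 1) * (N ^ (-1 + δ)) ^ (3 / 4 : ℝ) := by gcongr
      _ = N ^ (δ + δ * (k + 1) + (-1 + δ) * (3 / 4)) := by
          rw [← Real.rpow_mul_natCast hN0.le, ← Real.rpow_mul hN0.le, ← Real.rpow_add hN0,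
            ← Real.rpow_add hN0]
          push_cast
          rfl
      -- `hδ1` keeps the δ-terms below 3/4 - 2/3 = 1/12. Any exponent below -1/2 would suffice,
      -- since its double must beat the factor N.
      _ ≤ N ^ (-(2 / 3) : ℝ) := hmono (by linarith)
  · rw [hlogN, hMN]
    calc 2 * (k : ℝ) ^ 2 * d ≤ 16 * k * (k + 2) * d * 1 := by
          rw [mul_one]
          have : 2 * (k : ℝ) ^ 2 ≤ 16 * k * (k + 2) := by
            have := mul_self_nonneg (k : ℝ)
            linarith
          exact mul_le_mul_of_nonneg_right this hd0.le
      _ ≤ _ := mul_le_mul_of_nonneg_left hlog1 (by positivity)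
  -- The constant C is chosen to make this exponent exactly -(k+2) log N.
  · rw [hlogN, hMN, hx, Real.rpow_def_of_pos hN0]
    refine le_of_eq ?_
    congr 1
    field_simp

end Asymptotics

end Percolation

/-! ### Passage to the limit -/

theorem proposition3p1 :
    ∃ ε₀ : ℝ, 0 < ε₀ ∧ ∀ k : ℕ, 1 ≤ k → ∀ c : ℝ, 0 < c → ∃ C : ℝ, 0 < C ∧
      ∀ ε : ℝ, 0 < ε → ε ≤ ε₀ → ∀ a : ℝ, 0 < a →
      ∀ (n d : ℕ → ℕ) (G : ∀ i, SimpleGraph (Fin (n i))),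
        Tendsto n atTop atTop →
        Tendsto d atTop atTop →
        (∀ i, (d i : ℝ) ≤ (n i : ℝ) ^ (1 - a)) →
        (∀ i, Percolation.IsRegular (G i) (d i)) →
        (∀ i, Percolation.GlobalExpansion (G i) c) →
        (∀ i, Percolation.LocalExpansion (G i) (d i) C ε) →
      ∀ φ : ℕ → ℝ,
        Tendsto φ atTop atTop →
        (∀ δ : ℝ, 0 < δ → ∀ᶠ i in atTop, φ i ≤ (n i : ℝ) ^ δ) →
      ∀ p : ℕ → unitInterval,
        (∀ᶠ i in atTop, (p i : ℝ) = 1 - (φ i / n i) ^ (1 / (d i : ℝ))) →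
        Tendsto
          (fun i => (Percolation.randomSubgraph (G i) (p i)).real
            {H | Percolation.HasUniqueKConnectedComponent (G i) k H})
          atTop (𝓝 1) := by
  refine ⟨1 / 4, by norm_num, fun k hk c hc => ⟨16 * k * (k + 2) / min c 1, ?_, ?_⟩⟩
  · have : 0 < min c 1 := lt_min hc one_pos
    have : (0 : ℝ) < k := by exact_mod_cast hk
    positivity
  intro ε _ hε a ha n d G hn hd hda hG hglob hloc φ hφ hφn p hp
  have hnR : Tendsto (fun i => (n i : ℝ)) atTop atTop := tendsto_natCast_atTop_atTop.comp hn
  have hdR : Tendsto (fun i => (d i : ℝ)) atTop atTop := tendsto_natCast_atTop_atTop.comp hd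
  -- δ absorbs every subpolynomial factor (φ, log n, constants, Λ); its two constraints serve the
  -- two first-round estimates.
  obtain ⟨δ, hδ, hδ1, hδ2⟩ : ∃ δ : ℝ, 0 < δ ∧ δ * (12 * (k + 3)) ≤ 1 ∧
      δ * (2 * (2 * k + 5)) ≤ a := by
    refine ⟨min (1 / (12 * (k + 3))) (a / (2 * (2 * k + 5))), by positivity, ?_, ?_⟩
    · rw [← le_div_iff₀ (by positivity)]
      exact min_le_left _ _
    · rw [← le_div_iff₀ (by positivity)]
      exact min_le_right _ _
  have hpow : ∀ s : ℝ, 0 < s → ∀ b : ℝ, ∀ᶠ i in atTop, b ≤ (n i : ℝ) ^ s := fun s hs b =>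
    ((tendsto_rpow_atTop hs).comp hnR).eventually_ge_atTop b
  have hneg : ∀ s : ℝ, 0 < s → Tendsto (fun i => (n i : ℝ) ^ (-s)) atTop (𝓝 0) := fun s hs =>
    (tendsto_rpow_neg_atTop hs).comp hnR
  have hbound : ∀ᶠ i in atTop, 1 - (2 * (n i : ℝ) ^ (-(1 / 3) : ℝ) + (n i : ℝ) ^ (-(a / 2))
      + 4 * k * (n i : ℝ)⁻¹) ≤ (Percolation.randomSubgraph (G i) (p i)).real
            {H | Percolation.HasUniqueKConnectedComponent (G i) k H} := by
    have hlogs : ∀ᶠ i in atTop, Real.log (n i) ≤ (n i : ℝ) ^ (δ / 2) := by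
      have h1 := (isLittleO_log_rpow_atTop (half_pos hδ)).bound one_pos
      filter_upwards [hnR.eventually h1, hnR.eventually_ge_atTop 1] with i hi hi1
      rw [one_mul, Real.norm_of_nonneg (Real.log_nonneg hi1),
        Real.norm_of_nonneg (by positivity)] at hi
      exact hi
    filter_upwards [hp, hlogs, hn.eventually_ge_atTop 1, hd.eventually_ge_atTop (12 * (k + 1)),
      hdR.eventually_ge_atTop (2 / δ), hφ.eventually_ge_atTop 1, hφn (δ / 2) (half_pos hδ),
      hpow (δ / 2) (half_pos hδ) (Real.exp (12 * (k + 1))),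
      (Real.tendsto_log_atTop.comp hnR).eventually_ge_atTop 1, hpow δ hδ (4 * Real.exp 1),
      (hneg (2 / 3) (by norm_num)).eventually_le_const (by norm_num : (0 : ℝ) < 1 / 2)]
      with i hpi hlog hn1 hd1 hdδ hφ1 hφδ hexp hlog1 hconst hhalf
    have : NeZero (n i) := ⟨by omega⟩
    have hn0 : (0 : ℝ) < n i := by exact_mod_cast hn1
    refine Percolation.one_sub_le_randomSubgraph_real ?_
    rw [hpi]
    refine Percolation.bernProb_not_hasUnique_le_rpow (hG i) hk hd1 hc (hglob i) (hloc i) hε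
      (by simp) hδ hδ1 hδ2 (hda i) hdδ hφ1 ?_ hlog1 hlog hconst hhalf
    calc φ i * Real.exp (12 * (k + 1)) ≤ (n i : ℝ) ^ (δ / 2) * (n i : ℝ) ^ (δ / 2) := by gcongr
      _ = (n i : ℝ) ^ δ := by rw [← Real.rpow_add hn0]; ring_nf
  have hlim : Tendsto (fun i => 1 - (2 * (n i : ℝ) ^ (-(1 / 3) : ℝ) + (n i : ℝ) ^ (-(a / 2))
      + 4 * k * (n i : ℝ)⁻¹)) atTop (𝓝 1) := by
    have h := tendsto_const_nhds (x := (1 : ℝ)) |>.sub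
      (((hneg (1 / 3) (by norm_num)).const_mul 2 |>.add (hneg (a / 2) (half_pos ha))).add
      ((tendsto_inv_atTop_zero.comp hnR).const_mul (4 * (k : ℝ))))
    simpa using h
  refine tendsto_of_tendsto_of_tendsto_of_le_of_le' hlim tendsto_const_nhds hbound
    (Eventually.of_forall fun i => ?_)
  exact Percolation.randomSubgraph_real_le_one _ _ _
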